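/- **Binary decision diagrams.** A BDD of index $k$ is a tuple $(Q,I,r,\delta)$ with a finite set of nodes $Q$ containing two distinct sinks $\bot,\top$, an index function $I:Q\to\{0,\dots,k\}$ with $I(\bot)=I(\top)=0$, a root $r\in Q$ with $I(r)=k$, and a transition function $\delta:(Q\setminus\{\bot,\top\})\times\{0,1\}\to Q$ such that: $\delta(\nu,0)\ne\delta(\nu,1)$ for all $\nu$; distinct non-sink nodes $\mu,\nu$ of the same index satisfy $\delta(\mu,0)\neq\delta(\nu,0)$ or $\delta(\mu,1)\ne\delta(\nu,1)$; the graph of $\delta$ is acyclic and $r$ is its unique node of in-degree $0$; $I(\delta(\nu,\alpha))<I(\nu)$. Its size is $|Q|$. $N(n,k)$ is the number of BDDs of size $n$ and index $k$, up to isomorphism. **Spines.** The spine of a BDD is the plane binary tree on its non-sink nodes, labelled by their indices, obtained by depth-first search from the root (child $\delta(\nu,0)$ before child $\delta(\nu,1)$, sinks omitted). A tree is a valid spine of index $k$ if it is the spine of some BDD of index $k$. The weight of a node $\nu$ of the spine $T$ of a BDD $B$ is the number of possible pairs $(\delta(\nu,0),\delta(\nu,1))$ in BDDs with spine $T$ when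 the transitions out of the nodes preceding $\nu$ in preorder have been chosen as in $B$; the cumulated weight $W(T)$ is the product of the weights of all nodes of $T$. The profile of a tree is $(t_0,\dots,t_j)$, with $j$ its maximal index and $t_i$ its number of nodes of index $i$. **Algorithm.** Lists are added componentwise after padding with zeros; $\epsilon$ is the empty list; $e^{(k)}=(0,\dots,0,1)$ has $k+1$ components. For $\boldsymbol p=(p_0,\dots,p_{k-1})$, $\mathrm{count}(n,\boldsymbol p,s)$ returns an associative array $d$ from lists to integers, computed as follows. Start with $d=\{\}$. For $i=0,\dots,n-1$: let $d_0=\{\epsilon:\sum_j p_j\}$ if $i=0$, and $d_0=\bigcup_{k_0=1}^{k-1}\mathrm{count}(i,(p_0,\dots,p_{k_0-1}),p_{k_0})$ otherwise. For each $(\boldsymbol\ell,w_0)\in d_0$: put $\boldsymbol p'=\boldsymbol p+\boldsymbol\ell$; let $d_1=\{\epsilon:-1+\sum_j p'_j\}$ if $n-1-i=0$, and $d_1=\bigcup_{k_1=1}^{k-1}\mathrm{count}(n-1-i,(p'_0,\dots,p'_{k_1-1}),p'_{k_1})$ otherwise. For each $(\boldsymbol r,w_1)\in d_1$: let $w=w_0w_1-s$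 if $n=1$ and $w=w_0w_1$ otherwise; if $w>0$, add $w$ to $d[\boldsymbol\ell+\boldsymbol r+e^{(k)}]$ (creating this key if it is absent). Return $d$. The memoized version stores each computed result $\mathrm{count}(n,\boldsymbol p,s)$ in a table and looks it up there instead of computing it again. **Proposition.** Let $n\ge2$ and $k\ge1$, and let $(2,0,\dots,0)$ have $k$ components. Then $$N(n,k)=\sum_{(\boldsymbol t,w)\in\mathrm{count}(n-2,(2,0,\dots,0),0)}w .$$ Moreover, the keys of $\mathrm{count}(n-2,(2,0,\dots,0),0)$ are exactly the profiles $\boldsymbol t$ of the valid spines of index $k$ with $n-2$ nodes, and the value at $\boldsymbol t$ is $\sum_T W(T)$ over the valid spines $T$ of index $k$ with $n-2$ nodes and profile $\boldsymbol t$; here $W(T)$ does not depend on the BDD $B$ with spine $T$ used to compute it. The memoized version of the algorithm, started with an empty table, returns the same associative array. -/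

import Mathlib

/-! ### Binary decision diagrams -/

/-- The nodes of a decision diagram whose set of decision nodes is `V`:
the two sinks `⊥`, `⊤` and the decision nodes. -/
inductive BDDNode (V : Type) : Type
  | bot : BDDNode V
  | top : BDDNode V
  | inner (v : V) : BDDNode V

namespace BDDNode

/-- Renaming of the decision nodes; the sinks are kept. -/
def map {V W : Type} (f : V → W) : BDDNode V → BDDNode W
  | .bot => .bot
  | .top => .top
  | .inner v => .inner (f v)

/-- Extension to all nodes of an index function on the decision nodes: sinks have index `0`. -/
def index {V : Type} (idx : V → ℕ) : BDDNode V → ℕ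
  | .bot => 0
  | .top => 0
  | .inner v => idx v

theorem map_id {V : Type} (q : BDDNode V) : q.map id = q := by
  cases q <;> rfl

theorem map_map {U V W : Type} (g : V → W) (f : U → V) (q : BDDNode U) :
    (q.map f).map g = q.map (g ∘ f) := by
  cases q <;> rfl

end BDDNode

/-- A (plane, reduced, ordered) binary decision diagram of index `k`, seen as an automaton,
with set of decision nodes `V`. Its set of nodes is `Q = BDDNode V`. The low child of `v` is
`δ v false`, its high child is `δ v true`. -/
structure BDD (k : ℕ) (V : Type) where
  /-- index of a decision node -/
  idx : V → ℕ
  /-- the root -/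
  root : BDDNode V
  /-- the transition function, defined on all nodes but the sinks -/
  δ : V → Bool → BDDNode V
  idx_le : ∀ v, idx v ≤ k
  index_root : root.index idx = k
  low_ne_high : ∀ v, δ v false ≠ δ v true
  reduced : ∀ v w, v ≠ w → idx v = idx w → δ v false ≠ δ w false ∨ δ v true ≠ δ w true
  acyclic : ∀ q : BDDNode V,
    ¬ Relation.TransGen (fun a b => ∃ v α, a = BDDNode.inner v ∧ δ v α = b) q q
  source_iff_root : ∀ q : BDDNode V, (∀ v α, δ v α ≠ q) ↔ q = root
  index_lt : ∀ v α, (δ v α).index idx < idx v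

namespace BDD

/-- Two diagrams are isomorphic if they differ by a renaming of the decision nodes. -/
def Iso {k : ℕ} {V W : Type} (B : BDD k V) (C : BDD k W) : Prop :=
  ∃ e : V ≃ W, (∀ v, C.idx (e v) = B.idx v) ∧ B.root.map e = C.root ∧
    ∀ v α, (B.δ v α).map e = C.δ (e v) α

theorem Iso.refl {k : ℕ} {V : Type} (B : BDD k V) : B.Iso B :=
  ⟨Equiv.refl V, fun _ => rfl, BDDNode.map_id _, fun _ _ => BDDNode.map_id _⟩

theorem Iso.symm {k : ℕ} {V W : Type} {B : BDD k V} {C : BDD k W} (h : B.Iso C) : C.Iso B := by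
  obtain ⟨e, h1, h2, h3⟩ := h
  refine ⟨e.symm, fun w => ?_, ?_, fun w α => ?_⟩
  · rw [← h1, Equiv.apply_symm_apply]
  · rw [← h2, BDDNode.map_map, Equiv.symm_comp_self, BDDNode.map_id]
  · have h := h3 (e.symm w) α
    rw [Equiv.apply_symm_apply] at h
    rw [← h, BDDNode.map_map, Equiv.symm_comp_self, BDDNode.map_id]

theorem Iso.trans {k : ℕ} {U V W : Type} {A : BDD k U} {B : BDD k V} {C : BDD k W}
    (h : A.Iso B) (h' : B.Iso C) : A.Iso C := by
  obtain ⟨e, h1, h2, h3⟩ := h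
  obtain ⟨e', h1', h2', h3'⟩ := h'
  refine ⟨e.trans e', fun v => ?_, ?_, fun v α => ?_⟩
  · rw [Equiv.trans_apply, h1', h1]
  · rw [← h2', ← h2, BDDNode.map_map, Equiv.coe_trans]
  · rw [Equiv.trans_apply, ← h3', ← h3, BDDNode.map_map, Equiv.coe_trans]

/-- Isomorphism of diagrams with `m` decision nodes. -/
def isoSetoid (k m : ℕ) : Setoid (BDD k (Fin m)) where
  r := Iso
  iseqv := ⟨Iso.refl, Iso.symm, Iso.trans⟩

end BDD

/-- `N(n, k)`: the number of binary decision diagrams of index `k` and size `n ≥ 2`, up to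
isomorphism. The size counts all nodes: the two sinks and `n - 2` decision nodes. -/
noncomputable def numBDD (n k : ℕ) : ℕ :=
  Nat.card (Quotient (BDD.isoSetoid k (n - 2)))

/-! ### Spines, profiles and weights -/

/-- The list of labels of a plane binary tree, in preorder. -/
def preorderList {α : Type} : BinaryTree α → List α
  | .nil => []
  | .node a l r => a :: (preorderList l ++ preorderList r)

namespace BDD

/-- Depth-first search from the node `q`, low child before high child, omitting the sinks, when
the decision nodes in `seen` have been visited already. It returns the tree of the newly visited
nodes and the set of all nodes visited by then. -/
def dfs {k : ℕ} {V : Type} [DecidableEq V] (B : BDD k V) :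
    BDDNode V → Finset V → BinaryTree V × Finset V
  | .bot, seen => (.nil, seen)
  | .top, seen => (.nil, seen)
  | .inner v, seen =>
    if v ∈ seen then (.nil, seen)
    else
      let low := dfs B (B.δ v false) (insert v seen)
      let high := dfs B (B.δ v true) low.2
      (.node v low.1 high.1, high.2)
termination_by q => q.index B.idx
decreasing_by
  · exact B.index_lt v false
  · exact B.index_lt v true

/-- The spanning tree of `B` found by depth-first search from the root. -/
def dfsTree {k : ℕ} {V : Type} [DecidableEq V] (B : BDD k V) : BinaryTree V :=
  (B.dfs B.root ∅).1

/-- The spine of `B`, as a plane binary tree in which every node carries its index. A missing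
child (`nil`) is an undefined transition, i.e. a half edge. -/
def spine {k : ℕ} {V : Type} [DecidableEq V] (B : BDD k V) : BinaryTree ℕ :=
  B.dfsTree.map B.idx

/-- `u` is visited before `v` in the preorder traversal of the spine of `B`. -/
def PreorderBefore {k : ℕ} {V : Type} [DecidableEq V] (B : BDD k V) (u v : V) : Prop :=
  (preorderList B.dfsTree).idxOf u < (preorderList B.dfsTree).idxOf v

/-- The weight of the node `v` of the spine of `B`: the number of possibilities for the pair of
transitions out of `v` in a diagram with the same spine as `B`, once the transitions out of the
nodes preceding `v` have been chosen as in `B`. -/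
noncomputable def nodeWeight {k : ℕ} {V : Type} [DecidableEq V] (B : BDD k V) (v : V) : ℕ :=
  Set.ncard {d : Bool → BDDNode V | ∃ C : BDD k V, C.idx = B.idx ∧ C.dfsTree = B.dfsTree ∧
    (∀ u, B.PreorderBefore u v → C.δ u = B.δ u) ∧ C.δ v = d}

/-- The cumulated weight of the whole spine of `B`: the product of the weights of its nodes. -/
noncomputable def cumulatedWeight {k : ℕ} {V : Type} [Fintype V] [DecidableEq V]
    (B : BDD k V) : ℕ :=
  ∏ v, B.nodeWeight v

end BDD

instance {V : Type} [Finite V] : Finite (BDDNode V) := by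
  refine Finite.of_surjective
    (fun x : Bool ⊕ V => match x with
      | .inl false => BDDNode.bot
      | .inl true => BDDNode.top
      | .inr v => BDDNode.inner v) ?_
  rintro (_ | _ | v)
  · exact ⟨.inl false, rfl⟩
  · exact ⟨.inl true, rfl⟩
  · exact ⟨.inr v, rfl⟩

instance {k : ℕ} {V : Type} [Finite V] : Finite (BDD k V) := by
  refine Finite.of_injective
    (fun B : BDD k V => ((fun v => (⟨B.idx v, Nat.lt_succ_of_le (B.idx_le v)⟩ : Fin (k + 1))),
      B.root, B.δ)) ?_
  intro B C h
  simp only [Prod.mk.injEq] at h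
  obtain ⟨h1, h2, h3⟩ := h
  have h1' : B.idx = C.idx := funext fun v => congrArg Fin.val (congrFun h1 v)
  cases B
  cases C
  simp only at h1' h2 h3
  subst h1' h2 h3
  rfl

/-- `𝒯_{m,k}`: the finite set of the valid spines with `m` nodes, i.e. the trees that are the
spine of some diagram of index `k`. -/
noncomputable def validSpines (m k : ℕ) : Finset (BinaryTree ℕ) :=
  (Set.finite_range (fun B : BDD k (Fin m) => B.spine)).toFinset

/-- `W(T)`: the cumulated weight of the spine `T`, that is, the number `B.cumulatedWeight` for a
diagram `B` with spine `T` (the maximum over all such `B`, which all give the same number). -/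
noncomputable def spineWeight (m k : ℕ) (T : BinaryTree ℕ) : ℕ :=
  sSup {c | ∃ B : BDD k (Fin m), B.spine = T ∧ B.cumulatedWeight = c}

/-- The profile `(p₀, …, p_i)` of a list of indices: `i` is the maximal index, and `p_j` is the
number of occurrences of `j`. The profile of an empty list is the empty list. -/
def profileOfIndices (L : List ℕ) : List ℕ :=
  if L = [] then [] else (List.range (L.foldr max 0 + 1)).map fun j => L.count j

/-- The profile of a tree whose nodes carry their indices. -/
def treeProfile (T : BinaryTree ℕ) : List ℕ :=
  profileOfIndices (preorderList T)

/-! ### The algorithm -/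

/-- Componentwise sum of two lists, the shorter one being padded with zeros. -/
def addLists : List ℕ → List ℕ → List ℕ
  | [], r => r
  | l, [] => l
  | a :: l, b :: r => (a + b) :: addLists l r

/-- The list `e⁽ᵏ⁾ = (0, …, 0, 1)` with `k + 1` components. -/
def unitList (k : ℕ) : List ℕ :=
  List.replicate k 0 ++ [1]

/-- Associative arrays that map profiles to integer weights. -/
abbrev WeightDict : Type := AList (fun _ : List ℕ => ℤ)

/-- Adds `w` to the value at the key `t`, or creates the key `t` with value `w`. -/
def WeightDict.addWeight (d : WeightDict) (t : List ℕ) (w : ℤ) : WeightDict :=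
  match d.lookup t with
  | some w' => d.insert t (w' + w)
  | none => d.insert t w

/-- The union of the arrays returned by `call` for the subtrees whose root has index
`j = 1, …, k - 1`, where `p = (p₀, …, p_{k-1})`: such a root has pool profile
`(p₀, …, p_{j-1})` and level rank `p_j`. -/
def childDict {M : Type → Type} [Monad M] (call : List ℕ → ℕ → M WeightDict) (p : List ℕ) :
    M WeightDict :=
  (List.range' 1 (p.length - 1)).foldlM
    (fun d j => do
      let d' ← call (p.take j) (p.getD j 0)
      return d ∪ d') ∅

/-- The body of the algorithm, in an arbitrary monad and with the recursive calls abstracted: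
`call m _ p s` stands for the recursive call for subtrees of size `m < n`. -/
def countBody {M : Type → Type} [Monad M] (n : ℕ) (p : List ℕ) (s : ℕ)
    (call : (m : ℕ) → m < n → List ℕ → ℕ → M WeightDict) : M WeightDict :=
  (List.finRange n).foldlM
    (fun d i => do
      -- the left subtree has size `i`
      let d₀ ←
        if i.val = 0 then pure (AList.singleton [] (p.sum : ℤ))
        else childDict (call i.val i.isLt) p
      d₀.entries.foldlM
        (fun d e₀ => do
          let p' := addLists p e₀.1
          -- the right subtree has size `n - 1 - i`
          let d₁ ←
            if n - 1 - i.val = 0 then pure (AList.singleton [] (-1 + (p'.sum : ℤ)))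
            else childDict (call (n - 1 - i.val) (by have := i.isLt; omega)) p'
          return d₁.entries.foldl
            (fun d e₁ =>
              let w : ℤ := if n = 1 then e₀.2 * e₁.2 - (s : ℤ) else e₀.2 * e₁.2
              if 0 < w then
                WeightDict.addWeight d
                  (addLists (addLists e₀.1 e₁.1) (unitList p.length)) w
              else d) d) d) ∅

/-- Algorithm `count(n, p, s)`: subtrees of size `n` whose root has pool profile
`p = (p₀, …, p_{k-1})`, level rank `s` and index `k`. -/
def count (n : ℕ) (p : List ℕ) (s : ℕ) : WeightDict :=
  Id.run (countBody n p s fun m _ p' s' => pure (count m p' s'))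
termination_by n

/-- Tables of already computed results `count(n, p, s)`. -/
abbrev MemoTable : Type := AList (fun _ : ℕ × List ℕ × ℕ => WeightDict)

/-- The memoized version of `count`: a result present in the table is returned at once, any other
result is stored in the table when it has been computed. -/
def countMemo (n : ℕ) (p : List ℕ) (s : ℕ) : StateM MemoTable WeightDict := do
  let table ← get
  match table.lookup (n, p, s) with
  | some d => return d
  | none =>
    let d ← countBody n p s fun m _ p' s' => countMemo m p' s'
    modify fun table' => table'.insert (n, p, s) d
    return d
termination_by n

/-- The pool profile `(2, 0, …, 0)` of length `k ≥ 1` of the root of a spine of index `k`. -/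
def rootPool (k : ℕ) : List ℕ :=
  2 :: List.replicate (k - 1) 0

/-! ### Sequences of constrained choices -/

/-! Fix the set of decision nodes, the index function and the spanning tree of a diagram. The
diagram is then its transition function, and being a diagram with this tree amounts to a local
condition `StepOK` at each node, tested in preorder. An edge of the tree must go to the root of its
subtree; a missing edge must go to a sink or to a node visited before; indices drop, the two targets
differ, and no earlier node of the same index has the same pair of targets (`dfs_spec`, `dfs_eq`,
`exists_of_seqGood`).

The crux is that the number of admissible pairs at a node does not depend on the earlier choices
(`ncard_stepOK`). A missing edge chooses from a pool whose size is read off from the indices. For a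
leaf, the pairs taken by earlier nodes of the same index must be excluded. These pairs are distinct
and all lie in the pool: an earlier node of the same index is not an ancestor, so its whole subtree
has been visited (`subtree_subset_of_le`, `child_mem_of_le`). If some subtree is nonempty, its root
is a new node and nothing has to be excluded. Hence the number of diagrams on a tree is the product
`treeWeight` of these counts, and every node weight is the corresponding factor (`ncard_seqGood`,
`ncard_next_choice`).

An isomorphism that preserves the spanning tree is the identity, and diagrams with equal spines can
be moved onto the same tree. So `numBDD` is the sum of `treeWeight` over the valid spines
(`numBDD_eq_sum`), which are the layered trees of positive weight (`mem_validSpines_iff`).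

The algorithm evaluates this sum recursively: a node's weight depends on the earlier nodes only
through the number of them at each index, and so only through profiles. An array is treated as a
functional on test functions of the profile (`weightedSum`, `Represents`), and strong induction on
the size gives `countSpec`. Indicator functions then recover the single entries; positivity of all
stored values identifies the keys. The monadic program is compared with a pure fold once for all
monads (`countBody_rel`), which serves both `count` and its memoized version. -/

theorem ncard_biUnion_of_const {α β : Type} [Finite α] [Finite β] {D : Set α} {F : α → Set β}
    {n : ℕ} (hd : ∀ d ∈ D, ∀ d' ∈ D, ∀ b, b ∈ F d → b ∈ F d' → d = d')
    (hF : ∀ d ∈ D, (F d).ncard = n) : (⋃ d ∈ D, F d).ncard = D.ncard * n := by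
  classical
  have h : (⋃ d ∈ D, F d) =
      ((Set.toFinite D).toFinset.biUnion fun d => (Set.toFinite (F d)).toFinset : Finset β) := by
    ext; simp
  rw [h, Set.ncard_coe_finset, Finset.card_biUnion, Finset.sum_const_nat (m := n),
    Set.ncard_eq_toFinset_card D]
  · intro d hd'
    rw [← Set.ncard_eq_toFinset_card]
    exact hF d (by simpa using hd')
  · intro d h1 d' h2 hne
    refine Finset.disjoint_left.2 fun b h3 h4 => hne ?_
    exact hd d (by simpa using h1) d' (by simpa using h2) b (by simpa using h3) (by simpa using h4)

section Sequential

variable {ι V X : Type}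

/-- Every item of the list satisfies its constraint `P S x δ`, where `S` lists the keys of the
items that come earlier. -/
def SeqGood (key : ι → V) (P : List V → ι → (V → X) → Prop) (δ : V → X) :
    List V → List ι → Prop
  | _, [] => True
  | S, x :: L => P S x δ ∧ SeqGood key P δ (S ++ [key x]) L

/-- The product of the numbers `c S x` over the items `x` of a list, where `S` lists the keys of
the items that come earlier. -/
def seqProd (key : ι → V) (c : List V → ι → ℕ) : List V → List ι → ℕ
  | _, [] => 1
  | S, x :: L => c S x * seqProd key c (S ++ [key x]) L

variable {key : ι → V} {P : List V → ι → (V → X) → Prop} {c : List V → ι → ℕ}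

theorem seqGood_append {δ : V → X} {S : List V} {L L' : List ι} :
    SeqGood key P δ S (L ++ L') ↔
      SeqGood key P δ S L ∧ SeqGood key P δ (S ++ L.map key) L' := by
  induction L generalizing S with
  | nil => simp [SeqGood]
  | cons x L ih => simp [SeqGood, ih, and_assoc]

theorem seqProd_append {S : List V} {L L' : List ι} :
    seqProd key c S (L ++ L') = seqProd key c S L * seqProd key c (S ++ L.map key) L' := by
  induction L generalizing S with
  | nil => simp [seqProd]
  | cons x L ih => simp [seqProd, ih, mul_assoc]

theorem seqGood_iff {δ : V → X} {S : List V} {L : List ι} :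
    SeqGood key P δ S L ↔
      ∀ L₁ x L₂, L = L₁ ++ x :: L₂ → P (S ++ L₁.map key) x δ := by
  constructor
  · rintro h L₁ x L₂ rfl
    rw [seqGood_append] at h
    exact h.2.1
  · intro h
    induction L generalizing S with
    | nil => trivial
    | cons x L ih =>
      refine ⟨by simpa using h [] x L rfl, ih fun L₁ y L₂ e => ?_⟩
      simpa using h (x :: L₁) y L₂ (by rw [e]; rfl)

theorem prod_map_eq_seqProd {f : ι → ℕ} {S : List V} {L : List ι}
    (h : ∀ L₁ x L₂, L = L₁ ++ x :: L₂ → f x = c (S ++ L₁.map key) x) :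
    (L.map f).prod = seqProd key c S L := by
  induction L generalizing S with
  | nil => rfl
  | cons x L ih =>
    rw [List.map_cons, List.prod_cons, seqProd, ← ih]
    · rw [h [] x L rfl]; simp
    · intro L₁ y L₂ e
      rw [h (x :: L₁) y L₂ (by rw [e]; rfl)]; simp

theorem seqProd_pos_iff {S : List V} {L : List ι} :
    0 < seqProd key c S L ↔ ∀ L₁ x L₂, L = L₁ ++ x :: L₂ → 0 < c (S ++ L₁.map key) x := by
  constructor
  · rintro h L₁ x L₂ rfl
    rw [seqProd_append] at h
    exact Nat.pos_of_mul_pos_right (Nat.pos_of_mul_pos_left h)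
  · intro h
    induction L generalizing S with
    | nil => exact Nat.one_pos
    | cons x L ih =>
      refine Nat.mul_pos (by simpa using h [] x L rfl) (ih fun L₁ y L₂ e => ?_)
      simpa using h (x :: L₁) y L₂ (by rw [e]; rfl)

/-- The constraint of an item depends only on the values at its key and at the earlier keys. -/
def SeqLocal (key : ι → V) (P : List V → ι → (V → X) → Prop) : Prop :=
  ∀ S x δ δ', (∀ u ∈ S, δ u = δ' u) → δ (key x) = δ' (key x) → P S x δ → P S x δ'

theorem SeqGood.congr (hP : SeqLocal key P) {δ δ' : V → X} {S : List V} {L : List ι}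
    (hS : ∀ u ∈ S, δ u = δ' u) (hL : ∀ x ∈ L, δ (key x) = δ' (key x))
    (h : SeqGood key P δ S L) : SeqGood key P δ' S L := by
  induction L generalizing S with
  | nil => trivial
  | cons x L ih =>
    refine ⟨hP _ _ _ _ hS (hL x (by simp)) h.1, ih ?_ (fun y hy => hL y (by simp [hy])) h.2⟩
    intro u hu
    rcases List.mem_append.1 hu with hu | hu
    · exact hS u hu
    · rw [List.mem_singleton.1 hu]; exact hL x (by simp)

/-- The number of extensions of a partial sequence of choices, if the number of choices at every
step does not depend on the choices made before. -/
theorem ncard_seqGood [DecidableEq V] [Finite V] [Finite X] (hP : SeqLocal key P) {S : List V} {L : List ι}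
    (hnd : (S ++ L.map key).Nodup) {δ₀ : V → X} {G : (V → X) → Prop} (hG : G δ₀)
    (hGc : ∀ δ δ', (∀ u ∈ S, δ u = δ' u) → G δ → G δ')
    (hc : ∀ L₁ x L₂, L = L₁ ++ x :: L₂ → ∀ δ, G δ → SeqGood key P δ S L₁ →
      {d | P (S ++ L₁.map key) x (Function.update δ (key x) d)}.ncard =
        c (S ++ L₁.map key) x) :
    {δ : V → X | (∀ v, v ∉ L.map key → δ v = δ₀ v) ∧ SeqGood key P δ S L}.ncard =
      seqProd key c S L := by
  induction L generalizing S δ₀ G with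
  | nil =>
    have : {δ : V → X | (∀ v, v ∉ ([] : List ι).map key → δ v = δ₀ v) ∧
        SeqGood key P δ S []} = {δ₀} := by
      ext δ
      simp [SeqGood, funext_iff]
    rw [this, Set.ncard_singleton, seqProd]
  | cons x L ih =>
    have hxS : key x ∉ S := fun h => by
      have := (List.nodup_append.1 hnd).2.2 _ h (key x) (by simp)
      exact this rfl
    have hxL : key x ∉ L.map key := by
      have := (List.nodup_append.1 hnd).2.1
      rw [List.map_cons, List.nodup_cons] at this
      exact this.1
    have hupd : ∀ d, ∀ u ∈ S, δ₀ u = Function.update δ₀ (key x) d u := fun d u hu => by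
      rw [Function.update_of_ne (by rintro rfl; exact hxS hu)]
    -- The solutions are sorted by their value at the first key; the fibre over each admissible
    -- value is counted by induction.
    set D : Set X := {d | P S x (Function.update δ₀ (key x) d)} with hD
    have hDc : D.ncard = c S x := by
      simpa using hc [] x L rfl δ₀ hG trivial
    have hset : {δ : V → X | (∀ v, v ∉ (x :: L).map key → δ v = δ₀ v) ∧
        SeqGood key P δ S (x :: L)} = ⋃ d ∈ D, {δ : V → X |
          (∀ v, v ∉ L.map key → δ v = Function.update δ₀ (key x) d v) ∧
          SeqGood key P δ (S ++ [key x]) L} := by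
      ext δ
      simp only [Set.mem_iUnion, Set.mem_ofPred_eq, exists_prop]
      constructor
      · rintro ⟨h1, h2, h3⟩
        have hval : ∀ v, v ∉ L.map key → δ v = Function.update δ₀ (key x) (δ (key x)) v := by
          intro v hv
          by_cases hvx : v = key x
          · subst hvx; simp
          · rw [Function.update_of_ne hvx]
            exact h1 v (by simp only [List.map_cons, List.mem_cons, not_or]; exact ⟨hvx, hv⟩)
        refine ⟨δ (key x), hP _ _ _ _ (fun u hu => hval u ?_) (by simp) h2, hval, h3⟩
        intro hu'
        exact (List.nodup_append.1 hnd).2.2 _ hu u (by simp [hu']) rfl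
      · rintro ⟨d, hd, h1, h2⟩
        refine ⟨fun v hv => ?_, hP _ _ _ _ (fun u hu => ?_) ?_ hd, h2⟩
        · simp only [List.map_cons, List.mem_cons, not_or] at hv
          rw [h1 v hv.2, Function.update_of_ne hv.1]
        · refine (h1 u ?_).symm
          intro hu'
          exact (List.nodup_append.1 hnd).2.2 _ hu u (by simp [hu']) rfl
        · exact (h1 _ hxL).symm
    have hfib : ∀ d ∈ D, {δ : V → X |
          (∀ v, v ∉ L.map key → δ v = Function.update δ₀ (key x) d v) ∧
          SeqGood key P δ (S ++ [key x]) L}.ncard = seqProd key c (S ++ [key x]) L := by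
      intro d hd
      -- `G` records that all items treated so far are satisfied; the hypothesis on the counts is
      -- only available for such choices.
      refine ih (G := fun δ => G δ ∧ P S x δ) (by simpa using hnd)
        ⟨hGc _ _ (hupd d) hG, hd⟩ ?_ ?_
      · intro δ δ' h ⟨h1, h2⟩
        exact ⟨hGc δ δ' (fun u hu => h u (by simp [hu])) h1,
          hP _ _ _ _ (fun u hu => h u (by simp [hu])) (h _ (by simp)) h2⟩
      · rintro L₁ y L₂ rfl δ ⟨h1, h2⟩ h3
        simpa using hc (x :: L₁) y L₂ rfl δ h1 ⟨h2, h3⟩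
    rw [hset, seqProd, ← hDc]
    refine ncard_biUnion_of_const (fun d _ d' _ δ h h' => ?_) hfib
    have e1 := h.1 _ hxL
    have e2 := h'.1 _ hxL
    rw [Function.update_self] at e1 e2
    exact e1.symm.trans e2

/-- If a sequence of choices exists, every initial part of it extends each possible next
choice. -/
theorem ncard_next_choice [DecidableEq V] [Finite V] [Finite X] (hP : SeqLocal key P) {L₁ L₂ : List ι} {x : ι}
    (hnd : ((L₁ ++ x :: L₂).map key).Nodup)
    (hc : ∀ L₁' y L₂', L₁ ++ x :: L₂ = L₁' ++ y :: L₂' → ∀ δ, SeqGood key P δ [] L₁' →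
      {d | P (L₁'.map key) y (Function.update δ (key y) d)}.ncard = c (L₁'.map key) y)
    {δ₀ : V → X} (h₀ : SeqGood key P δ₀ [] (L₁ ++ x :: L₂)) :
    {d | ∃ δ, SeqGood key P δ [] (L₁ ++ x :: L₂) ∧ (∀ u ∈ L₁.map key, δ u = δ₀ u) ∧
      δ (key x) = d}.ncard = c (L₁.map key) x := by
  -- The existing solution `δ₀` makes each count positive; since the counts do not depend on the
  -- choices, no partial solution can get stuck.
  have hpos : ∀ L₁' y L₂', L₁ ++ x :: L₂ = L₁' ++ y :: L₂' → 0 < c (L₁'.map key) y := by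
    intro L₁' y L₂' e
    rw [e, seqGood_append] at h₀
    rw [← hc L₁' y L₂' e δ₀ h₀.1, Set.ncard_pos (Set.toFinite _)]
    exact ⟨δ₀ (key y), by simpa using h₀.2.1⟩
  have h₁ := (seqGood_append.1 h₀).1
  rw [← hc L₁ x L₂ rfl δ₀ h₁]
  congr 1
  ext d
  simp only [Set.mem_ofPred_eq]
  have hnd' := hnd
  rw [List.map_append, List.nodup_append] at hnd'
  have hx1 : key x ∉ L₁.map key := fun h => hnd'.2.2 _ h (key x) (by simp) rfl
  have hupd : ∀ u ∈ L₁.map key, Function.update δ₀ (key x) d u = δ₀ u := fun u hu => by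
    rw [Function.update_of_ne (by rintro rfl; exact hx1 hu)]
  constructor
  · rintro ⟨δ, h, h1, h2⟩
    refine hP _ _ _ _ (fun u hu => ?_) ?_ (seqGood_append.1 h).2.1
    · rw [hupd u (by simpa using hu), h1 u (by simpa using hu)]
    · rw [h2, Function.update_self]
  · intro hd
    have hL1 : SeqGood key P (Function.update δ₀ (key x) d) [] L₁ :=
      h₁.congr hP (by simp) fun y hy => (hupd _ (List.mem_map_of_mem hy)).symm
    have hcard := ncard_seqGood (c := c) hP (S := L₁.map key ++ [key x]) (L := L₂)
      (by simpa using hnd) (δ₀ := Function.update δ₀ (key x) d)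
      (G := fun δ => SeqGood key P δ [] (L₁ ++ [x]))
      (by rw [seqGood_append]; exact ⟨hL1, hd, trivial⟩)
      (fun δ δ' h h' => h'.congr hP (by simp) fun y hy => h _ (by
        rcases List.mem_append.1 hy with hy | hy
        · simp only [List.mem_append]; exact .inl (List.mem_map_of_mem hy)
        · rw [List.mem_singleton.1 hy]; simp))
      (by
        rintro A y C rfl δ h1 h2
        have := hc (L₁ ++ x :: A) y C (by simp) δ (by
          have e : L₁ ++ x :: A = (L₁ ++ [x]) ++ A := by simp
          rw [e, seqGood_append]
          exact ⟨h1, by simpa using h2⟩)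
        simpa using this)
    have hne : 0 < {δ : V → X | (∀ v, v ∉ L₂.map key → δ v = Function.update δ₀ (key x) d v) ∧
        SeqGood key P δ (L₁.map key ++ [key x]) L₂}.ncard := by
      rw [hcard, seqProd_pos_iff]
      rintro A y C rfl
      simpa using hpos (L₁ ++ x :: A) y C (by simp)
    obtain ⟨δ, hδ, hδ'⟩ := (Set.ncard_pos (Set.toFinite _)).1 hne
    have hx2 : key x ∉ L₂.map key := by
      have := hnd'.2.1
      rw [List.map_cons, List.nodup_cons] at this
      exact this.1
    have hagree : ∀ u ∈ L₁.map key, δ u = Function.update δ₀ (key x) d u := fun u hu =>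
      hδ u fun hu' => hnd'.2.2 _ hu u (by simp only [List.map_cons, List.mem_cons]; exact .inr hu') rfl
    refine ⟨δ, ?_, fun u hu => (hagree u hu).trans (hupd u hu), by rw [hδ _ hx2]; simp⟩
    rw [seqGood_append]
    refine ⟨hL1.congr hP (by simp) fun y hy => (hagree _ (List.mem_map_of_mem hy)).symm, ?_, ?_⟩
    · refine hP _ _ _ _ (fun u hu => (hagree u (by simpa using hu)).symm) (hδ _ hx2).symm hd
    · simpa using hδ'

end Sequential

/-! ### Diagrams with a given spanning tree -/

/-- The nodes of a plane binary tree in preorder, each one with its two subtrees. -/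
def treeSteps {α : Type} : BinaryTree α → List (α × BinaryTree α × BinaryTree α)
  | .nil => []
  | .node a l r => (a, l, r) :: (treeSteps l ++ treeSteps r)

theorem map_fst_treeSteps {α : Type} (t : BinaryTree α) :
    (treeSteps t).map Prod.fst = preorderList t := by
  induction t with
  | nil => rfl
  | node a l r hl hr => simp [treeSteps, preorderList, hl, hr]

theorem preorderList_map {α β : Type} (f : α → β) (t : BinaryTree α) :
    preorderList (t.map f) = (preorderList t).map f := by
  induction t with
  | nil => rfl
  | node a l r hl hr => simp [preorderList, BinaryTree.map, hl, hr]

/-- `q` is an admissible target for the edge to the subtree `t`: the root of `t`, or a sink or a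
node of the list `S` if `t` is empty. -/
def EdgeOK {V : Type} (S : List V) : BinaryTree V → BDDNode V → Prop
  | .nil, q => ∀ w, q = .inner w → w ∈ S
  | .node a _ _, q => q = .inner a

/-- The pair `d` of transitions is admissible at the node `x.1` with subtrees `x.2.1` and
`x.2.2`, after the nodes of the list `S` with transitions `δ`. -/
structure StepOK {V : Type} (idx : V → ℕ) (S : List V) (x : V × BinaryTree V × BinaryTree V)
    (δ : V → Bool → BDDNode V) : Prop where
  low : EdgeOK S x.2.1 (δ x.1 false)
  high : EdgeOK (S ++ preorderList x.2.1) x.2.2 (δ x.1 true)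
  index_lt : ∀ α, (δ x.1 α).index idx < idx x.1
  ne : δ x.1 false ≠ δ x.1 true
  reduced : ∀ u ∈ S, idx u = idx x.1 → δ u false ≠ δ x.1 false ∨ δ u true ≠ δ x.1 true

theorem seqLocal_stepOK {V : Type} (idx : V → ℕ) : SeqLocal Prod.fst (StepOK idx) := by
  intro S x δ δ' hS hx h
  refine ⟨hx ▸ h.low, hx ▸ h.high, hx ▸ h.index_lt, hx ▸ h.ne, fun u hu hu' => ?_⟩
  rw [← hS u hu, ← hx]
  exact h.reduced u hu hu'

theorem EdgeOK.mono {V : Type} {S S' : List V} {t : BinaryTree V} {q : BDDNode V}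
    (hS : ∀ w ∈ S, w ∈ S') (h : EdgeOK S t q) : EdgeOK S' t q := by
  cases t with
  | nil => exact fun w hw => hS w (h w hw)
  | node a l r => exact h

/-- Depth-first search marks `v` as visited before it explores the children of `v`, whereas `StepOK`
leaves `v` out of the list of possible targets. The difference is harmless because the index drops
along edges, so `v` is not its own child. -/
theorem BDD.edgeOK_erase {k : ℕ} {V : Type} (B : BDD k V) {S S' : List V} {v : V} {t : BinaryTree V} {α : Bool}
    (hS : ∀ w ∈ S, w = v ∨ w ∈ S') (h : EdgeOK S t (B.δ v α)) : EdgeOK S' t (B.δ v α) := by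
  cases t with
  | nil =>
    intro w hw
    rcases hS w (h w hw) with rfl | h'
    · have := B.index_lt w α
      rw [hw] at this
      exact absurd this (lt_irrefl _)
    · exact h'
  | node a l r => exact h

namespace BDD

section Dfs

variable {k : ℕ} {V : Type} [DecidableEq V]

theorem dfs_inner_of_mem (B : BDD k V) {v : V} {S : Finset V} (h : v ∈ S) :
    B.dfs (.inner v) S = (.nil, S) := by
  rw [dfs, if_pos h]

theorem dfs_inner_of_notMem (B : BDD k V) {v : V} {S : Finset V} (h : v ∉ S) :
    B.dfs (.inner v) S = (.node v (B.dfs (B.δ v false) (insert v S)).1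
      (B.dfs (B.δ v true) (B.dfs (B.δ v false) (insert v S)).2).1,
      (B.dfs (B.δ v true) (B.dfs (B.δ v false) (insert v S)).2).2) := by
  rw [dfs, if_neg h]

/-- The tree found by depth-first search satisfies the constraints at all of its nodes. -/
theorem dfs_spec (B : BDD k V) (q : BDDNode V) (S : List V) (hS : S.Nodup) :
    (B.dfs q S.toFinset).2 = (S ++ preorderList (B.dfs q S.toFinset).1).toFinset ∧
    (S ++ preorderList (B.dfs q S.toFinset).1).Nodup ∧
    EdgeOK S (B.dfs q S.toFinset).1 q ∧
    SeqGood Prod.fst (StepOK B.idx) B.δ S (treeSteps (B.dfs q S.toFinset).1) := by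
  induction hb : q.index B.idx using Nat.strong_induction_on generalizing q S with
  | _ b ih =>
    cases q with
    | bot => simp [dfs, preorderList, EdgeOK, treeSteps, SeqGood, hS]
    | top => simp [dfs, preorderList, EdgeOK, treeSteps, SeqGood, hS]
    | inner v =>
      by_cases hv : v ∈ S
      · rw [dfs_inner_of_mem B (by simpa using hv)]
        simp [preorderList, EdgeOK, treeSteps, SeqGood, hS, hv]
      · rw [dfs_inner_of_notMem B (by simpa using hv)]
        have hins : insert v S.toFinset = (S ++ [v]).toFinset := by
          ext; simp
        have hnd : (S ++ [v]).Nodup := by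
          refine List.nodup_append.2 ⟨hS, by simp, fun a ha b hb e => hv ?_⟩
          rw [List.mem_singleton] at hb
          rwa [← hb, ← e]
        rw [hins]
        obtain ⟨l1, l2, l3, l4⟩ := ih _ (hb ▸ B.index_lt v false) (B.δ v false) _ hnd rfl
        set l := (B.dfs (B.δ v false) (S ++ [v]).toFinset).1
        rw [l1]
        obtain ⟨r1, r2, r3, r4⟩ := ih _ (hb ▸ B.index_lt v true) (B.δ v true) _ l2 rfl
        set r := (B.dfs (B.δ v true) (S ++ [v] ++ preorderList l).toFinset).1
        refine ⟨by rw [r1]; simp [preorderList], by simpa [preorderList] using r2, rfl, ?_, ?_⟩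
        · refine ⟨B.edgeOK_erase ?_ l3, B.edgeOK_erase ?_ r3, B.index_lt v, B.low_ne_high v,
            fun u hu e => B.reduced u v (fun h => hv (h ▸ hu)) e⟩
          · intro w hw
            simpa [or_comm] using hw
          · intro w hw
            simp only [List.mem_append, List.mem_singleton] at hw ⊢
            tauto
        · rw [seqGood_append, map_fst_treeSteps]
          exact ⟨l4, r4⟩

/-- Depth-first search finds any tree whose nodes satisfy the constraints. -/
theorem dfs_eq (B : BDD k V) {t : BinaryTree V} {q : BDDNode V} {S : List V}
    (hnd : (S ++ preorderList t).Nodup) (hq : EdgeOK S t q)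
    (hg : SeqGood Prod.fst (StepOK B.idx) B.δ S (treeSteps t)) :
    B.dfs q S.toFinset = (t, (S ++ preorderList t).toFinset) := by
  induction t generalizing q S with
  | nil =>
    cases q with
    | bot => simp [dfs, preorderList]
    | top => simp [dfs, preorderList]
    | inner v =>
      rw [dfs_inner_of_mem B (by simpa using hq v rfl)]
      simp [preorderList]
  | node v l r hl hr =>
    have hq' : q = .inner v := hq
    subst hq'
    have hv : v ∉ S := fun h => (List.nodup_append.1 hnd).2.2 v h v (by simp [preorderList]) rfl
    rw [dfs_inner_of_notMem B (by simpa using hv)]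
    have hins : insert v S.toFinset = (S ++ [v]).toFinset := by
      ext; simp
    rw [treeSteps, SeqGood, seqGood_append, map_fst_treeSteps] at hg
    obtain ⟨h1, h2, h3⟩ := hg
    have hnd' : (S ++ [v] ++ preorderList l ++ preorderList r).Nodup := by
      simpa [preorderList] using hnd
    rw [hins, hl (List.nodup_append.1 hnd').1 (EdgeOK.mono (by simp +contextual) h1.low) h2,
      hr hnd' (EdgeOK.mono (by
        simp only [List.mem_append]; tauto) h1.high) h3]
    simp [preorderList]

theorem dfsTree_nodup (B : BDD k V) : (preorderList B.dfsTree).Nodup :=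
  (B.dfs_spec B.root [] List.nodup_nil).2.1

theorem edgeOK_dfsTree (B : BDD k V) : EdgeOK [] B.dfsTree B.root :=
  (B.dfs_spec B.root [] List.nodup_nil).2.2.1

theorem seqGood_dfsTree (B : BDD k V) :
    SeqGood Prod.fst (StepOK B.idx) B.δ [] (treeSteps B.dfsTree) :=
  (B.dfs_spec B.root [] List.nodup_nil).2.2.2

end Dfs

end BDD

/-! ### Targets of transitions, and reachability from the root -/

theorem preorderList_subset_of_mem_treeSteps {V : Type} {t l r : BinaryTree V} {v : V}
    (h : (v, l, r) ∈ treeSteps t) :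
    (∀ w ∈ preorderList l, w ∈ preorderList t) ∧ ∀ w ∈ preorderList r, w ∈ preorderList t := by
  induction t with
  | nil => simp [treeSteps] at h
  | node a l' r' hl hr =>
    simp only [treeSteps, List.mem_cons, List.mem_append, Prod.mk.injEq] at h
    simp only [preorderList, List.mem_cons, List.mem_append]
    rcases h with ⟨rfl, rfl, rfl⟩ | h | h
    · tauto
    · have := hl h; exact ⟨fun w hw => .inr (.inl (this.1 w hw)), fun w hw => .inr (.inl (this.2 w hw))⟩
    · have := hr h; exact ⟨fun w hw => .inr (.inr (this.1 w hw)), fun w hw => .inr (.inr (this.2 w hw))⟩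

theorem exists_split_of_mem_preorderList {V : Type} {t : BinaryTree V} {v : V}
    (h : v ∈ preorderList t) :
    ∃ L₁ l r L₂, treeSteps t = L₁ ++ (v, l, r) :: L₂ := by
  rw [← map_fst_treeSteps, List.mem_map] at h
  obtain ⟨⟨v', l, r⟩, hx, rfl⟩ := h
  obtain ⟨L₁, L₂, e⟩ := List.append_of_mem hx
  exact ⟨L₁, l, r, L₂, e⟩

theorem keys_subset_preorderList {V : Type} {t : BinaryTree V} {L₁ L₂ v l r}
    (e : treeSteps t = L₁ ++ (v, l, r) :: L₂) : ∀ w ∈ L₁.map Prod.fst, w ∈ preorderList t := by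
  intro w hw
  rw [← map_fst_treeSteps, e, List.map_append]
  exact List.mem_append_left _ hw

theorem EdgeOK.mem {V : Type} {S : List V} {t : BinaryTree V} {w : V}
    (h : EdgeOK S t (.inner w)) : w ∈ S ∨ w ∈ preorderList t := by
  cases t with
  | nil => exact .inl (h w rfl)
  | node a l r =>
    obtain rfl := BDDNode.inner.inj h
    exact .inr (by simp [preorderList])

/-- The targets of the transitions lie in the tree. -/
theorem mem_of_seqGood {V : Type} {idx : V → ℕ} {t : BinaryTree V} {δ : V → Bool → BDDNode V}
    (h : SeqGood Prod.fst (StepOK idx) δ [] (treeSteps t)) {v w : V} {α : Bool}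
    (hv : v ∈ preorderList t) (e : δ v α = .inner w) : w ∈ preorderList t := by
  obtain ⟨L₁, l, r, L₂, hL⟩ := exists_split_of_mem_preorderList hv
  have hs := seqGood_iff.1 h L₁ _ L₂ hL
  have hsub := keys_subset_preorderList hL
  have hlr := preorderList_subset_of_mem_treeSteps (t := t) (v := v) (l := l) (r := r)
    (by rw [hL]; simp)
  rw [List.nil_append] at hs
  cases α
  · have := hs.low
    simp only [e] at this
    rcases this.mem with h' | h'
    · exact hsub w h'
    · exact hlr.1 w h'
  · have := hs.high
    simp only [e] at this
    rcases this.mem with h' | h'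
    · rcases List.mem_append.1 h' with h' | h'
      · exact hsub w h'
      · exact hlr.1 w h'
    · exact hlr.2 w h'

namespace BDD

variable {k : ℕ} {V : Type} [DecidableEq V]

/-- Depth-first search from the root visits all decision nodes. -/
theorem mem_dfsTree (B : BDD k V) (v : V) : v ∈ preorderList B.dfsTree := by
  -- Every node other than the root has a parent, whose index is larger and at most `k`.
  induction hb : k - B.idx v using Nat.strong_induction_on generalizing v with
  | _ b ih =>
    by_cases hroot : BDDNode.inner v = B.root
    · have := B.edgeOK_dfsTree
      rw [← hroot] at this
      simpa using this.mem
    · have := mt (B.source_iff_root (.inner v)).1 hroot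
      push Not at this
      obtain ⟨u, α, hu⟩ := this
      have h1 := B.index_lt u α
      rw [hu] at h1
      have h2 := B.idx_le u
      exact mem_of_seqGood B.seqGood_dfsTree
        (ih _ (by simp only [BDDNode.index] at h1; omega) u rfl) hu

end BDD

/-! ### Trees with decreasing labels -/

/-- The labels of a tree decrease from the root to the leaves, are positive, and are smaller than
`b`. -/
def Layered : ℕ → BinaryTree ℕ → Prop
  | _, .nil => True
  | b, .node k l r => 1 ≤ k ∧ k < b ∧ Layered k l ∧ Layered k r

theorem Layered.mono {b b' : ℕ} (h : b ≤ b') {t : BinaryTree ℕ} (ht : Layered b t) :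
    Layered b' t := by
  cases t with
  | nil => trivial
  | node k l r => exact ⟨ht.1, ht.2.1.trans_le h, ht.2.2⟩

theorem Layered.lt {b : ℕ} {t : BinaryTree ℕ} (ht : Layered b t) :
    ∀ j ∈ preorderList t, 1 ≤ j ∧ j < b := by
  induction t generalizing b with
  | nil => simp [preorderList]
  | node k l r hl hr =>
    obtain ⟨h1, h2, h3, h4⟩ := ht
    simp only [preorderList, List.mem_cons, List.mem_append]
    rintro j (rfl | h | h)
    · exact ⟨h1, h2⟩
    · exact ⟨(hl h3 j h).1, (hl h3 j h).2.trans h2⟩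
    · exact ⟨(hr h4 j h).1, (hr h4 j h).2.trans h2⟩

theorem layered_of_seqGood {V : Type} {idx : V → ℕ} {δ : V → Bool → BDDNode V}
    {t : BinaryTree V} {S : List V} {q : BDDNode V} {b : ℕ} (hq : EdgeOK S t q)
    (hqb : q.index idx < b)
    (h : SeqGood Prod.fst (StepOK idx) δ S (treeSteps t)) : Layered b (t.map idx) := by
  induction t generalizing S q b with
  | nil => trivial
  | node v l r hl hr =>
    rw [treeSteps, SeqGood, seqGood_append, map_fst_treeSteps] at h
    obtain ⟨h1, h2, h3⟩ := h
    have hq' : q = .inner v := hq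
    subst hq'
    -- Decision nodes have positive index because the index of a child is smaller.
    refine ⟨(Nat.zero_le _).trans_lt (h1.index_lt true), hqb, ?_, ?_⟩
    · exact hl (EdgeOK.mono (by simp +contextual) h1.low) (h1.index_lt false) h2
    · exact hr (EdgeOK.mono (by simp only [List.mem_append]; tauto) h1.high) (h1.index_lt true) h3

/-- A tree with root label `k`. -/
def HasRoot (k : ℕ) : BinaryTree ℕ → Prop
  | .nil => False
  | .node a _ _ => a = k

/-- Sinks have index `0`, so for `k ≥ 1` the root is a decision node and the tree is not empty. -/
theorem BDD.hasRoot_spine {k : ℕ} {V : Type} [DecidableEq V] (B : BDD k V) (hk : 1 ≤ k) :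
    HasRoot k B.spine := by
  have h := B.edgeOK_dfsTree
  have hr := B.index_root
  unfold BDD.spine
  cases ht : B.dfsTree with
  | nil =>
    rw [ht] at h
    cases hq : B.root with
    | inner w => exact absurd (h w hq) (by simp)
    | bot => rw [hq] at hr; simp only [BDDNode.index] at hr; omega
    | top => rw [hq] at hr; simp only [BDDNode.index] at hr; omega
  | node a l r =>
    rw [ht] at h
    have h' : B.root = .inner a := h
    rw [h'] at hr
    exact hr

theorem BDD.layered_spine {k : ℕ} {V : Type} [DecidableEq V] (B : BDD k V) :
    Layered (k + 1) B.spine :=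
  layered_of_seqGood B.edgeOK_dfsTree (by rw [B.index_root]; omega) B.seqGood_dfsTree

/-! ### Weights -/

/-- The number of nodes of index less than `k` among the two sinks and the nodes with the indices
in `S`. -/
def poolSize (k : ℕ) (S : List ℕ) : ℕ := 2 + S.countP (· < k)

/-- The number of possible pairs of transitions out of a node of index `k` with subtrees `l` and
`r`, if `S` lists the indices of the nodes that come before. -/
def ownWeight (S : List ℕ) (k : ℕ) : BinaryTree ℕ → BinaryTree ℕ → ℕ
  | .nil, .nil => poolSize k S * (poolSize k S - 1) - S.count k
  | .nil, .node _ _ _ => poolSize k S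
  | .node a l r, .nil => poolSize k (S ++ preorderList (.node a l r)) - 1
  | .node _ _ _, .node _ _ _ => 1

/-- The product of the weights of the nodes of a tree, if `S` lists the indices of the nodes that
come before the tree. -/
def treeWeight : BinaryTree ℕ → List ℕ → ℕ
  | .nil, _ => 1
  | .node k l r, S => ownWeight S k l r *
      (treeWeight l (S ++ [k]) * treeWeight r (S ++ [k] ++ preorderList l))

/-- `ownWeight` for a tree whose nodes have indices given by `idx`. -/
def stepWeight {V : Type} (idx : V → ℕ) (S : List V) (x : V × BinaryTree V × BinaryTree V) : ℕ :=
  ownWeight (S.map idx) (idx x.1) (x.2.1.map idx) (x.2.2.map idx)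

theorem seqProd_stepWeight {V : Type} (idx : V → ℕ) (t : BinaryTree V) (S : List V) :
    seqProd Prod.fst (stepWeight idx) S (treeSteps t) = treeWeight (t.map idx) (S.map idx) := by
  induction t generalizing S with
  | nil => rfl
  | node v l r hl hr =>
    rw [treeSteps, seqProd, seqProd_append, hl, hr, map_fst_treeSteps, BinaryTree.map, treeWeight]
    simp [stepWeight, preorderList_map]

/-- Indices strictly decrease along the tree, so `y` is not an ancestor of `x`. In preorder, the
subtree of a node that precedes `x` without being an ancestor of `x` is finished before `x`. -/
theorem subtree_subset_of_le {V : Type} {idx : V → ℕ} {t : BinaryTree V} {b : ℕ}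
    (ht : Layered b (t.map idx)) {L₁ L₂ x y} (e : treeSteps t = L₁ ++ x :: L₂) (hy : y ∈ L₁)
    (hle : idx y.1 ≤ idx x.1) :
    ∀ w, w ∈ preorderList y.2.1 ∨ w ∈ preorderList y.2.2 → w ∈ L₁.map Prod.fst := by
  induction t generalizing b L₁ L₂ with
  | nil => simp [treeSteps] at e
  | node v l r hl hr =>
    obtain ⟨-, -, h3, h4⟩ := ht
    rw [treeSteps] at e
    cases L₁ with
    | nil => simp at hy
    | cons z A =>
      rw [List.cons_append, List.cons.injEq] at e
      obtain ⟨rfl, e⟩ := e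
      have hx : x ∈ treeSteps l ++ treeSteps r := by rw [e]; simp
      have hlt : idx x.1 < idx v := by
        have hlr : x.1 ∈ preorderList l ∨ x.1 ∈ preorderList r := by
          rw [← map_fst_treeSteps, ← map_fst_treeSteps]
          exact (List.mem_append.1 hx).imp List.mem_map_of_mem List.mem_map_of_mem
        rcases hlr with h | h
        · exact (h3.lt _ (by rw [preorderList_map]; exact List.mem_map_of_mem h)).2
        · exact (h4.lt _ (by rw [preorderList_map]; exact List.mem_map_of_mem h)).2
      have hyA : y ∈ A := by
        rcases List.mem_cons.1 hy with rfl | h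
        · exact absurd (hle.trans_lt hlt) (lt_irrefl _)
        · exact h
      intro w hw
      rw [List.map_cons]
      refine List.mem_cons_of_mem _ ?_
      rcases List.append_eq_append_iff.1 e with ⟨A', rfl, hr'⟩ | ⟨C, hl', hC⟩
      · rw [List.map_append, List.mem_append, map_fst_treeSteps]
        rcases List.mem_append.1 hyA with hy' | hy'
        · have := preorderList_subset_of_mem_treeSteps (v := y.1) (l := y.2.1) (r := y.2.2) hy'
          exact .inl (hw.elim (this.1 w) (this.2 w))
        · exact .inr (hr h4 hr' hy' w hw)
      · cases C with
        | nil =>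
          rw [List.append_nil] at hl'
          have := preorderList_subset_of_mem_treeSteps (v := y.1) (l := y.2.1) (r := y.2.2)
            (by rw [hl']; exact hyA)
          rw [← hl', map_fst_treeSteps]
          exact hw.elim (this.1 w) (this.2 w)
        | cons c C =>
          rw [List.cons_append, List.cons.injEq] at hC
          obtain ⟨rfl, -⟩ := hC
          exact hl h3 hl' hyA w hw

/-- A target of `u` was visited before `u` or lies in the subtree of `u`, which is finished before
`x`. For `idx u = idx x.1`, the pair of targets of `u` therefore lies in the pool of `x`, and
excluding it removes exactly one candidate. -/
theorem child_mem_of_le {V : Type} {idx : V → ℕ} {t : BinaryTree V} {b : ℕ}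
    (ht : Layered b (t.map idx)) {L₁ L₂ x} (e : treeSteps t = L₁ ++ x :: L₂)
    {δ : V → Bool → BDDNode V} (h : SeqGood Prod.fst (StepOK idx) δ [] L₁) {u w : V} {α : Bool}
    (hu : u ∈ L₁.map Prod.fst) (hle : idx u ≤ idx x.1) (hw : δ u α = .inner w) :
    w ∈ L₁.map Prod.fst := by
  obtain ⟨y, hy, rfl⟩ := List.mem_map.1 hu
  have hsub := subtree_subset_of_le ht e hy hle
  obtain ⟨A, C, rfl⟩ := List.append_of_mem hy
  have hs := seqGood_iff.1 h A y C rfl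
  have hA : ∀ w ∈ A.map Prod.fst, w ∈ (A ++ y :: C).map Prod.fst := by
    intro w hw
    rw [List.map_append]
    exact List.mem_append_left _ hw
  rw [List.nil_append] at hs
  cases α
  · have := hs.low
    rw [hw] at this
    exact this.mem.elim (hA w) fun h => hsub w (.inl h)
  · have := hs.high
    rw [hw] at this
    rcases this.mem with h | h
    · exact (List.mem_append.1 h).elim (hA w) fun h => hsub w (.inl h)
    · exact hsub w (.inr h)

theorem pairwise_of_seqGood {V : Type} {idx : V → ℕ} {δ : V → Bool → BDDNode V} {S : List V} {L}
    (h : SeqGood Prod.fst (StepOK idx) δ S L)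
    (hS : S.Pairwise fun u v => idx u = idx v → δ u false ≠ δ v false ∨ δ u true ≠ δ v true) :
    (S ++ L.map Prod.fst).Pairwise
      fun u v => idx u = idx v → δ u false ≠ δ v false ∨ δ u true ≠ δ v true := by
  induction L generalizing S with
  | nil => simpa using hS
  | cons x L ih =>
    have := ih h.2 (List.pairwise_append.2 ⟨hS, by simp, fun u hu v hv => by
      rw [List.mem_singleton.1 hv]; exact h.1.reduced u hu⟩)
    simpa using this

theorem reduced_of_seqGood {V : Type} {idx : V → ℕ} {δ : V → Bool → BDDNode V} {L}
    (h : SeqGood Prod.fst (StepOK idx) δ [] L) {u v : V} (hu : u ∈ L.map Prod.fst)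
    (hv : v ∈ L.map Prod.fst) (hne : u ≠ v) (hi : idx u = idx v) :
    δ u false ≠ δ v false ∨ δ u true ≠ δ v true := by
  have := pairwise_of_seqGood h List.Pairwise.nil
  rw [List.nil_append] at this
  have hsymm : Std.Symm fun u v : V =>
      idx u = idx v → δ u false ≠ δ v false ∨ δ u true ≠ δ v true :=
    ⟨fun u v h e => (h e.symm).imp Ne.symm Ne.symm⟩
  exact this.forall hu hv hne hi

/-! ### Pools and the number of choices at a node -/

section Pool

variable {V : Type} [DecidableEq V]

open Classical in
/-- The nodes of index less than `k` among the sinks and the nodes in `S`. -/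
noncomputable def poolFinset (idx : V → ℕ) (k : ℕ) (S : List V) : Finset (BDDNode V) :=
  insert .bot (insert .top
    ((S.toFinset.filter fun u => idx u < k).image BDDNode.inner))

theorem mem_poolFinset {idx : V → ℕ} {k : ℕ} (hk : 1 ≤ k) {S : List V} {q : BDDNode V} :
    q ∈ poolFinset idx k S ↔ q.index idx < k ∧ ∀ w, q = .inner w → w ∈ S := by
  cases q with
  | bot => simp [poolFinset, BDDNode.index]; omega
  | top => simp [poolFinset, BDDNode.index]; omega
  | inner v => simp [poolFinset, BDDNode.index, and_comm]

theorem card_poolFinset (idx : V → ℕ) (k : ℕ) {S : List V} (hS : S.Nodup) :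
    (poolFinset idx k S).card = poolSize k (S.map idx) := by
  classical
  rw [poolFinset, Finset.card_insert_of_notMem (by simp), Finset.card_insert_of_notMem (by simp),
    Finset.card_image_of_injective _ fun _ _ => BDDNode.inner.inj, poolSize, List.countP_map, List.countP_eq_length_filter]
  have : S.toFinset.filter (fun u => idx u < k) =
      (S.filter ((fun x => decide (x < k)) ∘ idx)).toFinset := by
    ext; simp
  rw [this, List.toFinset_card_of_nodup (hS.filter _)]
  omega

end Pool

theorem ncard_pairs {X : Type} (Q : X → X → Prop) :
    {d : Bool → X | Q (d false) (d true)}.ncard = {p : X × X | Q p.1 p.2}.ncard := by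
  have h : {d : Bool → X | Q (d false) (d true)} =
      (fun (p : X × X) b => cond b p.2 p.1) '' {p : X × X | Q p.1 p.2} := by
    ext d
    constructor
    · intro h
      exact ⟨(d false, d true), h, by ext b; cases b <;> rfl⟩
    · rintro ⟨p, h, rfl⟩
      exact h
  rw [h, Set.ncard_image_of_injective]
  intro p p' h
  exact Prod.ext (congrFun h false) (congrFun h true)

/-- In preorder the two subtrees of a node come right after it. This gives the disjointness of
earlier nodes, `l` and `r` from the absence of repetitions in the whole list. -/
theorem exists_treeSteps_eq {V : Type} {t l r : BinaryTree V} {v : V} {L₁ L₂}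
    (e : treeSteps t = L₁ ++ (v, l, r) :: L₂) : ∃ M, L₂ = treeSteps l ++ treeSteps r ++ M := by
  induction t generalizing L₁ L₂ with
  | nil => simp [treeSteps] at e
  | node a l' r' hl hr =>
    rw [treeSteps] at e
    cases L₁ with
    | nil =>
      simp only [List.nil_append, List.cons.injEq, Prod.mk.injEq] at e
      obtain ⟨⟨rfl, rfl, rfl⟩, rfl⟩ := e
      exact ⟨[], by simp⟩
    | cons z A =>
      rw [List.cons_append, List.cons.injEq] at e
      obtain ⟨-, e⟩ := e
      rcases List.append_eq_append_iff.1 e with ⟨A', rfl, hr'⟩ | ⟨C, hl', hC⟩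
      · exact hr hr'
      · cases C with
        | nil => exact hr (L₁ := []) (by simpa using hC.symm)
        | cons c C =>
          rw [List.cons_append, List.cons.injEq] at hC
          obtain ⟨rfl, rfl⟩ := hC
          obtain ⟨M, rfl⟩ := hl hl'
          exact ⟨M ++ treeSteps r', by simp⟩

theorem layered_of_mem_treeSteps {V : Type} {idx : V → ℕ} {t l r : BinaryTree V} {v : V} {b : ℕ}
    (ht : Layered b (t.map idx)) (h : (v, l, r) ∈ treeSteps t) :
    1 ≤ idx v ∧ Layered (idx v) (l.map idx) ∧ Layered (idx v) (r.map idx) := by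
  induction t generalizing b with
  | nil => simp [treeSteps] at h
  | node a l' r' hl hr =>
    obtain ⟨h1, h2, h3, h4⟩ := ht
    simp only [treeSteps, List.mem_cons, List.mem_append, Prod.mk.injEq] at h
    rcases h with ⟨rfl, rfl, rfl⟩ | h | h
    · exact ⟨h1, h3, h4⟩
    · exact hl h3 h
    · exact hr h4 h

theorem stepOK_update_iff {V : Type} [DecidableEq V] {idx : V → ℕ} {S : List V} {v : V}
    (hv : v ∉ S) {l r : BinaryTree V} {δ : V → Bool → BDDNode V} {d : Bool → BDDNode V} :
    StepOK idx S (v, l, r) (Function.update δ v d) ↔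
      (EdgeOK S l (d false) ∧ EdgeOK (S ++ preorderList l) r (d true) ∧
        ((d false).index idx < idx v ∧ (d true).index idx < idx v) ∧ d false ≠ d true ∧
        ∀ u ∈ S, idx u = idx v → δ u false ≠ d false ∨ δ u true ≠ d true) := by
  have hu : ∀ u ∈ S, Function.update δ v d u = δ u := fun u hu => by
    rw [Function.update_of_ne (by rintro rfl; exact hv hu)]
  constructor
  · intro h
    refine ⟨by simpa using h.low, by simpa using h.high, ⟨by simpa using h.index_lt false,
      by simpa using h.index_lt true⟩, by simpa using h.ne, fun u hu' hi => ?_⟩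
    simpa [hu u hu'] using h.reduced u hu' hi
  · rintro ⟨h1, h2, h3, h4, h5⟩
    refine ⟨by simpa using h1, by simpa using h2, ?_, by simpa using h4, fun u hu' hi => ?_⟩
    · intro α
      cases α
      · simpa using h3.1
      · simpa using h3.2
    · simpa [hu u hu'] using h5 u hu' hi

/-- The earlier transitions `δ` influence the admissible pairs only through the pairs used by
earlier nodes of the same index. These matter for leaves only, and there only their number enters.
-/
theorem ncard_stepOK {V : Type} [DecidableEq V] {idx : V → ℕ} {t : BinaryTree V} {b : ℕ}
    (ht : Layered b (t.map idx)) (hnd : (preorderList t).Nodup) {L₁ L₂ x}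
    (e : treeSteps t = L₁ ++ x :: L₂)
    {δ : V → Bool → BDDNode V} (h : SeqGood Prod.fst (StepOK idx) δ [] L₁) :
    {d | StepOK idx (L₁.map Prod.fst) x (Function.update δ x.1 d)}.ncard =
      stepWeight idx (L₁.map Prod.fst) x := by
  classical
  obtain ⟨v, l, r⟩ := x
  obtain ⟨M, rfl⟩ := exists_treeSteps_eq e
  obtain ⟨hv1, hl, hr⟩ := layered_of_mem_treeSteps ht (v := v) (l := l) (r := r) (by rw [e]; simp)
  have hchild : ∀ u ∈ L₁.map Prod.fst, idx u = idx v → ∀ α w, δ u α = .inner w →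
      w ∈ L₁.map Prod.fst := fun u hu hi α w hw => child_mem_of_le ht e h hu hi.le hw
  have hchild' : ∀ u ∈ L₁.map Prod.fst,
      (∀ α, (δ u α).index idx < idx u) ∧ δ u false ≠ δ u true := by
    intro u hu
    obtain ⟨y, hy, rfl⟩ := List.mem_map.1 hu
    obtain ⟨A, C, rfl⟩ := List.append_of_mem hy
    have := seqGood_iff.1 h A y C rfl
    exact ⟨this.index_lt, this.ne⟩
  have hred := fun u u' hu hu' => reduced_of_seqGood h (u := u) (v := u') hu hu'
  rw [← map_fst_treeSteps, e] at hnd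
  simp only [List.map_append, List.map_cons, map_fst_treeSteps] at hnd
  generalize L₁.map Prod.fst = S at hnd hchild hchild' hred
  have hSnd := (List.nodup_append.1 hnd).1
  have hvS : v ∉ S := fun h => (List.nodup_append.1 hnd).2.2 v h v (by simp) rfl
  have hlS : ∀ w ∈ preorderList l, w ∉ S := fun w hw h =>
    (List.nodup_append.1 hnd).2.2 w h w (by simp [hw]) rfl
  have hrS : ∀ w ∈ preorderList r, w ∉ S := fun w hw h =>
    (List.nodup_append.1 hnd).2.2 w h w (by simp [hw]) rfl
  have hlrnd := (List.nodup_append.1 (List.nodup_cons.1 (List.nodup_append.1 hnd).2.1).2).1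
  have hSl : (S ++ preorderList l).Nodup := List.nodup_append.2
    ⟨hSnd, (List.nodup_append.1 hlrnd).1, fun a ha b hb hab => hlS b hb (hab ▸ ha)⟩
  simp only [stepOK_update_iff hvS]
  rw [ncard_pairs fun q q' => EdgeOK S l q ∧ EdgeOK (S ++ preorderList l) r q' ∧
        (q.index idx < idx v ∧ q'.index idx < idx v) ∧ q ≠ q' ∧
        ∀ u ∈ S, idx u = idx v → δ u false ≠ q ∨ δ u true ≠ q']
  unfold stepWeight
  cases l with
  | nil =>
    simp only [preorderList, List.append_nil] at *
    cases r with
    | nil =>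
      -- For a leaf the choices are the ordered pairs of distinct pool elements outside `I`. The set
      -- `I` has one element per earlier node of the same index, since those nodes already satisfy
      -- the reducedness condition, and it consists of such pairs by `hchild`.
      set I : Finset (BDDNode V × BDDNode V) :=
        (S.toFinset.filter fun u => idx u = idx v).image fun u => (δ u false, δ u true) with hI
      have hset : {p : BDDNode V × BDDNode V | EdgeOK S .nil p.1 ∧ EdgeOK S .nil p.2 ∧
          (p.1.index idx < idx v ∧ p.2.index idx < idx v) ∧ p.1 ≠ p.2 ∧
          ∀ u ∈ S, idx u = idx v → δ u false ≠ p.1 ∨ δ u true ≠ p.2} =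
          ((poolFinset idx (idx v) S).offDiag \ I : Finset _) := by
        ext ⟨q, q'⟩
        simp only [Set.mem_ofPred_eq, EdgeOK, Finset.coe_sdiff, Set.mem_sdiff, Finset.mem_coe,
          Finset.mem_offDiag, mem_poolFinset hv1, hI, Finset.mem_image, Finset.mem_filter,
          List.mem_toFinset, Prod.mk.injEq, not_exists, not_and_or]
        constructor
        · rintro ⟨h1, h2, ⟨h3, h4⟩, h5, h6⟩
          exact ⟨⟨⟨h3, h1⟩, ⟨h4, h2⟩, h5⟩, fun u => by have := h6 u; tauto⟩
        · rintro ⟨⟨⟨h3, h1⟩, ⟨h4, h2⟩, h5⟩, h6⟩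
          exact ⟨h1, h2, ⟨h3, h4⟩, h5, fun u => by have := h6 u; tauto⟩
      rw [hset, Set.ncard_coe_finset, Finset.card_sdiff_of_subset, Finset.offDiag_card,
        card_poolFinset _ _ hSnd, hI, Finset.card_image_of_injOn]
      · simp only [BinaryTree.map, ownWeight]
        rw [Nat.mul_sub_one, List.count, List.countP_map, List.countP_eq_length_filter]
        congr 1
        have : S.toFinset.filter (fun u => idx u = idx v) =
            (S.filter ((fun x => x == idx v) ∘ idx)).toFinset := by
          ext; simp
        rw [this, List.toFinset_card_of_nodup (hSnd.filter _)]
      · intro u hu u' hu' huu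
        simp only [Finset.coe_filter, List.mem_toFinset, Set.mem_ofPred_eq] at hu hu'
        simp only [Prod.mk.injEq] at huu
        by_contra hne
        have := hred u u' hu.1 hu'.1 hne (hu.2.trans hu'.2.symm)
        tauto
      · intro p hp
        rw [hI, Finset.mem_image] at hp
        obtain ⟨u, hu, rfl⟩ := hp
        rw [Finset.mem_filter, List.mem_toFinset] at hu
        rw [Finset.mem_offDiag, mem_poolFinset hv1, mem_poolFinset hv1, ← hu.2]
        exact ⟨⟨(hchild' u hu.1).1 _, hchild u hu.1 hu.2 _⟩, ⟨(hchild' u hu.1).1 _,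
          hchild u hu.1 hu.2 _⟩, (hchild' u hu.1).2⟩
    | node a r₁ r₂ =>
      have ha : idx a < idx v := (hr.lt _ (by simp [BinaryTree.map, preorderList])).2
      have haS : a ∉ S := hrS a (by simp [preorderList])
      have hset : {p : BDDNode V × BDDNode V | EdgeOK S .nil p.1 ∧ EdgeOK S (.node a r₁ r₂) p.2 ∧
          (p.1.index idx < idx v ∧ p.2.index idx < idx v) ∧ p.1 ≠ p.2 ∧
          ∀ u ∈ S, idx u = idx v → δ u false ≠ p.1 ∨ δ u true ≠ p.2} =
          ((poolFinset idx (idx v) S).image fun q => (q, BDDNode.inner a) : Finset (BDDNode V × BDDNode V)) := by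
        ext ⟨q, q'⟩
        simp only [Set.mem_ofPred_eq, EdgeOK, Finset.coe_image, Set.mem_image, Finset.mem_coe,
          mem_poolFinset hv1, Prod.mk.injEq]
        constructor
        · rintro ⟨h1, h2, ⟨h3, h4⟩, h5, h6⟩
          exact ⟨q, ⟨h3, h1⟩, rfl, h2.symm⟩
        · rintro ⟨_, ⟨h3, h1⟩, rfl, rfl⟩
          -- The root `a` of the subtree is not visited yet, so no earlier node of the same index
          -- points to it and reducedness is automatic.
          exact ⟨h1, rfl, ⟨h3, ha⟩, fun h => haS (h1 a h), fun u hu hi =>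
            .inr fun h => haS (hchild u hu hi _ _ h)⟩
      rw [hset, Set.ncard_coe_finset, 
        Finset.card_image_of_injective _ (fun _ _ h => congrArg Prod.fst h),
        card_poolFinset _ _ hSnd]
      rfl
  | node a l₁ l₂ =>
    have ha : idx a < idx v := (hl.lt _ (by simp [BinaryTree.map, preorderList])).2
    have haS : a ∉ S := hlS a (by simp [preorderList])
    have hal : a ∈ preorderList (.node a l₁ l₂) := by simp [preorderList]
    cases r with
    | nil =>
      generalize hl' : BinaryTree.node a l₁ l₂ = l at *
      have hset : {p : BDDNode V × BDDNode V | EdgeOK S l p.1 ∧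
          EdgeOK (S ++ preorderList l) .nil p.2 ∧
          (p.1.index idx < idx v ∧ p.2.index idx < idx v) ∧ p.1 ≠ p.2 ∧
          ∀ u ∈ S, idx u = idx v → δ u false ≠ p.1 ∨ δ u true ≠ p.2} =
          -- The low subtree is already visited when the high edge is chosen, so it belongs to the
          -- pool; only its root, the low child, is forbidden.
          (((poolFinset idx (idx v) (S ++ preorderList l)).erase (.inner a)).image
            fun q => (BDDNode.inner a, q) : Finset (BDDNode V × BDDNode V)) := by
        subst hl'
        ext ⟨q, q'⟩
        simp only [Set.mem_ofPred_eq, EdgeOK, Finset.coe_image, Set.mem_image, Finset.mem_coe,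
          mem_poolFinset hv1, Prod.mk.injEq, Finset.mem_erase]
        constructor
        · rintro ⟨rfl, h2, ⟨h3, h4⟩, h5, h6⟩
          exact ⟨q', ⟨h5.symm, h4, h2⟩, rfl, rfl⟩
        · rintro ⟨_, ⟨h5, h4, h2⟩, rfl, rfl⟩
          exact ⟨rfl, h2, ⟨ha, h4⟩, h5.symm, fun u hu hi =>
            .inl fun h => haS (hchild u hu hi _ _ h)⟩
      rw [hset, Set.ncard_coe_finset, 
        Finset.card_image_of_injective _ (fun _ _ h => congrArg Prod.snd h),
        Finset.card_erase_of_mem, card_poolFinset _ _ hSl, List.map_append, ← preorderList_map]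
      · subst hl'
        rfl
      · rw [mem_poolFinset hv1]
        exact ⟨ha, fun w hw => by
          rw [← BDDNode.inner.inj hw]; exact List.mem_append_right _ hal⟩
    | node c r₁ r₂ =>
      have hc : idx c < idx v := (hr.lt _ (by simp [BinaryTree.map, preorderList])).2
      have hac : a ≠ c := (List.nodup_append.1 hlrnd).2.2 a hal c (by simp [preorderList])
      have hset : {p : BDDNode V × BDDNode V | EdgeOK S (.node a l₁ l₂) p.1 ∧
          EdgeOK (S ++ preorderList (.node a l₁ l₂)) (.node c r₁ r₂) p.2 ∧
          (p.1.index idx < idx v ∧ p.2.index idx < idx v) ∧ p.1 ≠ p.2 ∧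
          ∀ u ∈ S, idx u = idx v → δ u false ≠ p.1 ∨ δ u true ≠ p.2} =
          {(.inner a, .inner c)} := by
        ext ⟨q, q'⟩
        simp only [Set.mem_ofPred_eq, EdgeOK, Set.mem_singleton_iff, Prod.mk.injEq]
        constructor
        · rintro ⟨h1, h2, -⟩
          exact ⟨h1, h2⟩
        · rintro ⟨rfl, rfl⟩
          exact ⟨rfl, rfl, ⟨ha, hc⟩, fun h => hac (BDDNode.inner.inj h), fun u hu hi =>
            .inl fun h => haS (hchild u hu hi _ _ h)⟩
      rw [hset, Set.ncard_singleton]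
      rfl

/-! ### The diagrams with a given spine -/

theorem eq_or_exists_parent {V : Type} {idx : V → ℕ} {δ : V → Bool → BDDNode V}
    {t : BinaryTree V} {S : List V} {q : BDDNode V} (hq : EdgeOK S t q)
    (h : SeqGood Prod.fst (StepOK idx) δ S (treeSteps t)) {w : V} (hw : w ∈ preorderList t) :
    q = .inner w ∨ ∃ u α, δ u α = .inner w := by
  induction t generalizing S q with
  | nil => simp [preorderList] at hw
  | node v l r hl hr =>
    rw [treeSteps, SeqGood, seqGood_append, map_fst_treeSteps] at h
    obtain ⟨h1, h2, h3⟩ := h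
    simp only [preorderList, List.mem_cons, List.mem_append] at hw
    rcases hw with rfl | hw | hw
    · exact .inl hq
    · have := hl (h1.low.mono (S' := S ++ [v]) (by simp +contextual)) h2 hw
      exact .inr (this.elim (fun h => ⟨v, false, h⟩) id)
    · have := hr (h1.high.mono (S' := S ++ [v] ++ preorderList l)
        (by simp only [List.mem_append]; tauto)) h3 hw
      exact .inr (this.elim (fun h => ⟨v, true, h⟩) id)

theorem acyclic_of_index_lt {V : Type} {idx : V → ℕ} {δ : V → Bool → BDDNode V}
    (h : ∀ v α, (δ v α).index idx < idx v) (q : BDDNode V) :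
    ¬ Relation.TransGen (fun a b => ∃ v α, a = BDDNode.inner v ∧ δ v α = b) q q := by
  have key : ∀ a b, Relation.TransGen (fun a b => ∃ v α, a = BDDNode.inner v ∧ δ v α = b) a b →
      b.index idx < a.index idx := by
    intro a b hab
    induction hab with
    | single h' => obtain ⟨v, α, rfl, rfl⟩ := h'; exact h v α
    | tail _ h' ih => obtain ⟨v, α, rfl, rfl⟩ := h'; exact (h v α).trans ih
  exact fun hq => lt_irrefl _ (key q q hq)

namespace BDD

variable {k : ℕ} {V : Type}

/-- The root is determined by the transitions, as their only source. -/
theorem ext_of_idx_of_δ {B C : BDD k V} (h : B.idx = C.idx) (h' : B.δ = C.δ) : B = C := by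
  have hr : B.root = C.root := by
    rw [← C.source_iff_root, ← h', B.source_iff_root]
  cases B
  cases C
  simp only at h h' hr
  subst h h' hr
  rfl

variable [DecidableEq V]

/-- Transitions that satisfy the constraints at all nodes of a tree define a diagram with this
spanning tree. -/
theorem exists_of_seqGood {idx : V → ℕ} {T : BinaryTree V}
    (hnd : (preorderList T).Nodup) (hcov : ∀ v, v ∈ preorderList T)
    (hroot : HasRoot k (T.map idx)) (hlay : Layered (k + 1) (T.map idx))
    {δ : V → Bool → BDDNode V} (h : SeqGood Prod.fst (StepOK idx) δ [] (treeSteps T)) :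
    ∃ C : BDD k V, C.idx = idx ∧ C.dfsTree = T ∧ C.δ = δ := by
  obtain ⟨a, l, r, rfl⟩ : ∃ a l r, T = .node a l r := by
    cases T with
    | nil => exact hroot.elim
    | node a l r => exact ⟨a, l, r, rfl⟩
  have ha : idx a = k := hroot
  have hstep : ∀ v, ∃ S x, x.1 = v ∧ StepOK idx S x δ := by
    intro v
    obtain ⟨L₁, l, r, L₂, e⟩ := exists_split_of_mem_preorderList (hcov v)
    exact ⟨_, _, rfl, seqGood_iff.1 h _ _ _ e⟩
  have hlt : ∀ v α, (δ v α).index idx < idx v := by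
    intro v; obtain ⟨S, x, rfl, hx⟩ := hstep v; exact hx.index_lt
  have hne : ∀ v, δ v false ≠ δ v true := by
    intro v; obtain ⟨S, x, rfl, hx⟩ := hstep v; exact hx.ne
  have hle : ∀ v, idx v ≤ k := by
    intro v
    have := (hlay.lt (idx v) (by rw [preorderList_map]; exact List.mem_map_of_mem (hcov v))).2
    omega
  let C : BDD k V :=
    { idx := idx
      root := .inner a
      δ := δ
      idx_le := hle
      index_root := ha
      low_ne_high := hne
      reduced := fun v w hvw hi => reduced_of_seqGood h (by rw [map_fst_treeSteps]; exact hcov v)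
        (by rw [map_fst_treeSteps]; exact hcov w) hvw hi
      acyclic := acyclic_of_index_lt hlt
      source_iff_root := by
        -- The sinks must not be sources. Both transitions out of a node of minimal index lead to
        -- sinks, and they are distinct, so both sinks are reached.
        have hsink : ∃ v, ∀ α w, δ v α ≠ .inner w := by
          obtain ⟨v, -, hv⟩ := (InvImage.wf idx Nat.lt_wfRel.wf).has_min Set.univ ⟨a, trivial⟩
          exact ⟨v, fun α w e => hv w trivial (by have := hlt v α; rwa [e] at this)⟩
        have hsinks : ∀ q : BDDNode V, (∀ w, q ≠ .inner w) → ∃ v α, δ v α = q := by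
          obtain ⟨v, hv⟩ := hsink
          have h0 := hv false
          have h1 := hv true
          have h2 := hne v
          intro q hq
          refine ⟨v, ?_⟩
          generalize e0 : δ v false = q0 at *
          generalize e1 : δ v true = q1 at *
          cases q with
          | inner w => exact absurd rfl (hq w)
          | bot =>
            cases q0 with
            | inner w => exact absurd rfl (h0 w)
            | bot => exact ⟨_, e0⟩
            | top =>
              cases q1 with
              | inner w => exact absurd rfl (h1 w)
              | bot => exact ⟨_, e1⟩
              | top => exact absurd rfl h2
          | top =>
            cases q0 with
            | inner w => exact absurd rfl (h0 w)
            | top => exact ⟨_, e0⟩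
            | bot =>
              cases q1 with
              | inner w => exact absurd rfl (h1 w)
              | top => exact ⟨_, e1⟩
              | bot => exact absurd rfl h2
        intro q
        constructor
        · intro hq
          cases q with
          | bot =>
            obtain ⟨v, α, e⟩ := hsinks .bot (by simp)
            exact absurd e (hq v α)
          | top =>
            obtain ⟨v, α, e⟩ := hsinks .top (by simp)
            exact absurd e (hq v α)
          | inner w =>
            rcases eq_or_exists_parent (t := .node a l r) (S := []) (q := .inner a) rfl h
                (hcov w) with e | ⟨u, α, e⟩
            · exact e.symm
            · exact absurd e (hq u α)
        · rintro rfl v α e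
          have h1 := hlt v α
          rw [e] at h1
          have h2 := hle v
          simp only [BDDNode.index] at h1
          omega
      index_lt := hlt }
  refine ⟨C, rfl, ?_, rfl⟩
  have := C.dfs_eq (t := .node a l r) (q := .inner a) (S := []) (by simpa using hnd) rfl h
  exact congrArg Prod.fst this

variable [Finite V]

/-- The product formula: diagrams on a fixed labelled tree are the sequences of admissible choices
along its preorder. It also covers trees that carry no diagram, for which it says that the weight is
`0`. -/
theorem ncard_dfsTree_eq {idx : V → ℕ} {T : BinaryTree V}
    (hnd : (preorderList T).Nodup) (hcov : ∀ v, v ∈ preorderList T)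
    (hroot : HasRoot k (T.map idx)) (hlay : Layered (k + 1) (T.map idx)) :
    {C : BDD k V | C.idx = idx ∧ C.dfsTree = T}.ncard = treeWeight (T.map idx) [] := by
  have h1 : {C : BDD k V | C.idx = idx ∧ C.dfsTree = T}.ncard =
      -- The default value `.bot` plays no role, since the tree contains all decision nodes.
      {δ : V → Bool → BDDNode V | (∀ v, v ∉ (treeSteps T).map Prod.fst → δ v = fun _ => .bot) ∧
        SeqGood Prod.fst (StepOK idx) δ [] (treeSteps T)}.ncard := by
    rw [← Set.InjOn.ncard_image (f := BDD.δ)]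
    · congr 1
      ext δ
      simp only [Set.mem_image, Set.mem_ofPred_eq, map_fst_treeSteps]
      constructor
      · rintro ⟨C, ⟨rfl, rfl⟩, rfl⟩
        exact ⟨fun v hv => absurd (hcov v) hv, C.seqGood_dfsTree⟩
      · rintro ⟨-, h⟩
        obtain ⟨C, h1, h2, h3⟩ := exists_of_seqGood hnd hcov hroot hlay h
        exact ⟨C, ⟨h1, h2⟩, h3⟩
    · intro C hC C' hC' e
      exact ext_of_idx_of_δ (hC.1.trans hC'.1.symm) e
  rw [h1, ncard_seqGood (c := stepWeight idx) (δ₀ := fun _ _ => .bot) (seqLocal_stepOK idx)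
    (by rwa [List.nil_append, map_fst_treeSteps]) (G := fun _ => True) trivial
    (fun _ _ _ _ => trivial), seqProd_stepWeight, List.map_nil]
  intro L₁ x L₂ e δ _ h
  exact ncard_stepOK hlay hnd e h

/-- The node weight admits only choices that extend to a whole diagram, `stepWeight` all locally
admissible ones. They agree by `ncard_next_choice`, as `B` itself shows that the tree can be
completed. -/
theorem nodeWeight_eq (hk : 1 ≤ k) (B : BDD k V) {L₁ L₂ x}
    (e : treeSteps B.dfsTree = L₁ ++ x :: L₂) :
    B.nodeWeight x.1 = stepWeight B.idx (L₁.map Prod.fst) x := by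
  have hnd := B.dfsTree_nodup
  rw [← ncard_next_choice (c := stepWeight B.idx) (seqLocal_stepOK B.idx) (L₁ := L₁) (L₂ := L₂)
    (by rwa [← e, map_fst_treeSteps]) (fun L₁' y L₂' e' δ h =>
      ncard_stepOK B.layered_spine hnd (e.trans e') h)
    (δ₀ := B.δ) (by rw [← e]; exact B.seqGood_dfsTree), nodeWeight, ← e]
  congr 1
  ext d
  have hbefore : ∀ u, B.PreorderBefore u x.1 ↔ u ∈ L₁.map Prod.fst := by
    intro u
    have hx : x.1 ∉ L₁.map Prod.fst := by
      rw [← map_fst_treeSteps, e, List.map_append] at hnd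
      exact fun h => (List.nodup_append.1 hnd).2.2 _ h x.1 (by simp) rfl
    rw [PreorderBefore, ← map_fst_treeSteps, e, List.map_append, List.map_cons,
      List.idxOf_append_of_notMem hx, List.idxOf_cons_self, add_zero]
    constructor
    · intro h
      by_contra hu
      rw [List.idxOf_append_of_notMem hu] at h
      omega
    · intro h
      rw [List.idxOf_append_of_mem h]
      exact List.idxOf_lt_length_of_mem h
  simp only [Set.mem_ofPred_eq, hbefore]
  constructor
  · rintro ⟨C, h1, h2, h3, rfl⟩
    exact ⟨C.δ, by rw [← h1, ← h2]; exact C.seqGood_dfsTree, h3, rfl⟩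
  · rintro ⟨δ, h1, h2, rfl⟩
    obtain ⟨C, h3, h4, rfl⟩ :=
      exists_of_seqGood hnd B.mem_dfsTree (B.hasRoot_spine hk) B.layered_spine h1
    exact ⟨C, h3, h4, h2, rfl⟩

end BDD

theorem BDD.cumulatedWeight_eq {k : ℕ} {V : Type} [DecidableEq V] [Fintype V] (hk : 1 ≤ k)
    (B : BDD k V) : B.cumulatedWeight = treeWeight B.spine [] := by
  have huniv : Finset.univ = (preorderList B.dfsTree).toFinset := by
    ext v; simp [B.mem_dfsTree v]
  rw [cumulatedWeight, huniv, List.prod_toFinset _ B.dfsTree_nodup, ← map_fst_treeSteps,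
    List.map_map, prod_map_eq_seqProd (key := Prod.fst) (c := stepWeight B.idx) (S := []),
    seqProd_stepWeight, List.map_nil]
  · rfl
  · intro L₁ x L₂ e
    simpa using B.nodeWeight_eq hk e

theorem BDD.treeWeight_spine_pos {k : ℕ} {V : Type} [DecidableEq V] [Finite V] (hk : 1 ≤ k)
    (B : BDD k V) : 0 < treeWeight B.spine [] := by
  have := BDD.ncard_dfsTree_eq (k := k) (idx := B.idx) B.dfsTree_nodup B.mem_dfsTree
    (B.hasRoot_spine hk) B.layered_spine
  rw [spine, ← this, Set.ncard_pos (Set.toFinite _)]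
  exact ⟨B, rfl, rfl⟩

/-! ### Isomorphism classes and spines -/

/-- Distinct labels in `t` make the relabelling well defined, so the labels of `t'` may repeat. It
is used both to match two spanning trees and to read an index function off a spine. -/
theorem exists_map_eq {V W : Type} [Nonempty W] {t : BinaryTree V} {t' : BinaryTree W}
    (h : t.map (fun _ => ()) = t'.map fun _ => ()) (hnd : (preorderList t).Nodup) :
    ∃ f : V → W, t.map f = t' := by
  classical
  induction t generalizing t' with
  | nil =>
    cases t' with
    | nil => exact ⟨fun _ => Classical.arbitrary W, rfl⟩
    | node _ _ _ => simp [BinaryTree.map] at h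
  | node v l r hl hr =>
    cases t' with
    | nil => simp [BinaryTree.map] at h
    | node w l' r' =>
      simp only [BinaryTree.map, BinaryTree.node.injEq, true_and] at h
      simp only [preorderList, List.nodup_cons, List.mem_append, not_or] at hnd
      obtain ⟨⟨hvl, hvr⟩, hnd⟩ := hnd
      obtain ⟨h1, h2, h3⟩ := List.nodup_append.1 hnd
      obtain ⟨f, rfl⟩ := hl h.1 h1
      obtain ⟨g, rfl⟩ := hr h.2 h2
      have hcongr : ∀ (s : BinaryTree V) (f g : V → W), (∀ u ∈ preorderList s, f u = g u) →
          s.map f = s.map g := by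
        intro s f g hs
        induction s with
        | nil => rfl
        | node a l r hl hr =>
          simp only [preorderList, List.mem_cons, List.mem_append] at hs
          rw [BinaryTree.map, BinaryTree.map, hs a (.inl rfl), hl fun u hu => hs u (.inr (.inl hu)),
            hr fun u hu => hs u (.inr (.inr hu))]
      refine ⟨fun u => if u = v then w else if u ∈ preorderList l then f u else g u, ?_⟩
      rw [BinaryTree.map]
      congr 1
      · simp
      · refine hcongr _ _ _ fun u hu => ?_
        rw [if_neg (by rintro rfl; exact hvl hu), if_pos hu]
      · refine hcongr _ _ _ fun u hu => ?_
        rw [if_neg (by rintro rfl; exact hvr hu), if_neg fun h => h3 u h u hu rfl]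

theorem exists_preorderList_eq {α V : Type} (T : BinaryTree α) (L : List V)
    (h : L.length = (preorderList T).length) :
    ∃ t : BinaryTree V, preorderList t = L ∧ t.map (fun _ => ()) = T.map fun _ => () := by
  induction T generalizing L with
  | nil => exact ⟨.nil, (List.length_eq_zero_iff.1 h).symm, rfl⟩
  | node a l r hl hr =>
    cases L with
    | nil => simp [preorderList] at h
    | cons v L =>
      simp only [preorderList, List.length_cons, List.length_append, Nat.add_right_cancel_iff] at h
      obtain ⟨t₁, h1, h2⟩ := hl (L.take (preorderList l).length) (by
        rw [List.length_take]; omega)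
      obtain ⟨t₂, h3, h4⟩ := hr (L.drop (preorderList l).length) (by
        rw [List.length_drop]; omega)
      refine ⟨.node v t₁ t₂, ?_, ?_⟩
      · rw [preorderList, h1, h3, List.take_append_drop]
      · rw [BinaryTree.map, BinaryTree.map, h2, h4]

/-- The decision nodes of a diagram can be renamed. -/
theorem BDD.exists_iso {k : ℕ} {V W : Type} (B : BDD k V) (e : V ≃ W) : ∃ C : BDD k W, (∀ v, C.idx (e v) = B.idx v) ∧
    B.root.map e = C.root ∧ ∀ v α, (B.δ v α).map e = C.δ (e v) α := by
  have hidx : ∀ q : BDDNode V, (q.map e).index (B.idx ∘ e.symm) = q.index B.idx := by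
    intro q
    cases q <;> simp [BDDNode.map, BDDNode.index]
  have hinj : Function.Injective (BDDNode.map e) := by
    intro q q' h
    have := congrArg (BDDNode.map e.symm) h
    simpa [BDDNode.map_map, BDDNode.map_id] using this
  have hsurj : ∀ q, ∃ q', BDDNode.map e q' = q := fun q =>
    ⟨q.map e.symm, by simp [BDDNode.map_map, BDDNode.map_id]⟩
  have hlt : ∀ v α, ((B.δ (e.symm v) α).map e).index (B.idx ∘ e.symm) < (B.idx ∘ e.symm) v := by
    intro v α
    rw [hidx]
    exact B.index_lt _ _
  refine ⟨{
    idx := B.idx ∘ e.symm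
    root := B.root.map e
    δ := fun v α => (B.δ (e.symm v) α).map e
    idx_le := fun v => B.idx_le _
    index_root := by rw [hidx, B.index_root]
    low_ne_high := fun v h => B.low_ne_high _ (hinj h)
    reduced := fun v w hvw hi => (B.reduced _ _ (e.symm.injective.ne hvw) hi).imp hinj.ne hinj.ne
    acyclic := acyclic_of_index_lt hlt
    source_iff_root := ?_
    index_lt := hlt }, by simp, rfl, by simp⟩
  intro q
  obtain ⟨q, rfl⟩ := hsurj q
  rw [hinj.eq_iff, ← B.source_iff_root]
  constructor
  · intro h v α
    have := h (e v) α
    rw [e.symm_apply_apply] at this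
    exact fun h' => this (by rw [h'])
  · exact fun h v α h' => h _ _ (hinj h')

namespace BDD

variable {k : ℕ} {V W : Type} [DecidableEq V] [DecidableEq W]

theorem dfs_map {B : BDD k V} {C : BDD k W} (e : V ≃ W)
    (hδ : ∀ v α, (B.δ v α).map e = C.δ (e v) α) (q : BDDNode V) (S : Finset V) :
    C.dfs (q.map e) (S.map e.toEmbedding) =
      ((B.dfs q S).1.map e, (B.dfs q S).2.map e.toEmbedding) := by
  induction hb : q.index B.idx using Nat.strong_induction_on generalizing q S with
  | _ b ih =>
    cases q with
    | bot => simp [dfs, BDDNode.map, BinaryTree.map]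
    | top => simp [dfs, BDDNode.map, BinaryTree.map]
    | inner v =>
      by_cases hv : v ∈ S
      · rw [BDDNode.map, dfs_inner_of_mem _ hv, dfs_inner_of_mem _ (by simpa using hv)]
        rfl
      · have hins : insert (e v) (S.map e.toEmbedding) = (insert v S).map e.toEmbedding := by
          rw [Finset.map_insert]; rfl
        rw [BDDNode.map, dfs_inner_of_notMem _ hv, dfs_inner_of_notMem _ (by simpa using hv),
          ← hδ, ← hδ, hins, ih _ (hb ▸ B.index_lt v false) _ _ rfl,
          ih _ (hb ▸ B.index_lt v true) _ _ rfl]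
        rfl

theorem dfsTree_map {B : BDD k V} {C : BDD k W} (e : V ≃ W)
    (hr : B.root.map e = C.root) (hδ : ∀ v α, (B.δ v α).map e = C.δ (e v) α) :
    C.dfsTree = B.dfsTree.map e := by
  have := dfs_map e hδ B.root ∅
  rw [Finset.map_empty, hr] at this
  rw [dfsTree, this]
  rfl

theorem Iso.spine_eq {B : BDD k V} {C : BDD k W} (h : B.Iso C) : B.spine = C.spine := by
  obtain ⟨e, h1, h2, h3⟩ := h
  rw [spine, spine, dfsTree_map e h2 h3, ← BinaryTree.comp_map]
  congr 1
  ext v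
  exact (h1 v).symm

/-- Rigidity: the isomorphism carries the preorder list of one tree to that of the other. These
lists are equal and contain all decision nodes, so it is the identity. -/
theorem eq_of_iso {B C : BDD k V} (h : B.Iso C) (ht : B.dfsTree = C.dfsTree) : B = C := by
  obtain ⟨e, h1, h2, h3⟩ := h
  have hmap := congrArg preorderList (dfsTree_map e h2 h3)
  rw [← ht, preorderList_map] at hmap
  have he : ∀ v, e v = v := by
    intro v
    have hmap' : (preorderList B.dfsTree).map id = (preorderList B.dfsTree).map e := by
      rw [List.map_id]; exact hmap
    exact (List.map_inj_left.1 hmap' v (B.mem_dfsTree v)).symm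
  have he' : (e : V → V) = id := funext he
  refine ext_of_idx_of_δ (funext fun v => ?_) (funext fun v => funext fun α => ?_)
  · rw [← h1, he]
  · have := h3 v α
    rwa [he', BDDNode.map_id] at this

end BDD

theorem BDD.exists_iso_of_spine_eq {k m : ℕ} (hk : 1 ≤ k) {B C : BDD k (Fin m)}
    (h : B.spine = C.spine) :
    ∃ D : BDD k (Fin m), B.Iso D ∧ D.idx = C.idx ∧ D.dfsTree = C.dfsTree := by
  have hne : Nonempty (Fin m) := by
    have := B.hasRoot_spine hk
    unfold spine at this
    cases ht : B.dfsTree with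
    | nil => rw [ht] at this; exact this.elim
    | node v l r => exact ⟨v⟩
  have hshape : B.dfsTree.map (fun _ => ()) = C.dfsTree.map fun _ => () := by
    have := congrArg (fun t => t.map fun _ => ()) h
    simpa only [spine, ← BinaryTree.comp_map] using this
  obtain ⟨f, hf⟩ := exists_map_eq hshape B.dfsTree_nodup
  -- The tree of `C` contains every node and is the image under `f` of the tree of `B`; on a finite
  -- set, surjectivity makes `f` a bijection.
  have hsurj : Function.Surjective f := by
    intro w
    have := C.mem_dfsTree w
    rw [← hf, preorderList_map, List.mem_map] at this
    obtain ⟨v, -, hv⟩ := this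
    exact ⟨v, hv⟩
  let e := Equiv.ofBijective f ⟨Finite.injective_iff_surjective.2 hsurj, hsurj⟩
  obtain ⟨D, h1, h2, h3⟩ := B.exists_iso e
  refine ⟨D, ⟨e, h1, h2, h3⟩, funext fun w => ?_, (BDD.dfsTree_map e h2 h3).trans hf⟩
  obtain ⟨v, rfl⟩ := e.surjective w
  rw [h1]
  have hl := congrArg preorderList h
  rw [spine, spine, ← hf, ← BinaryTree.comp_map, preorderList_map, preorderList_map] at hl
  exact List.map_inj_left.1 hl v (B.mem_dfsTree v)

/-! ### Counting by spines, and valid spines as trees of positive weight -/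

theorem mem_validSpines_iff_exists {m k : ℕ} {T : BinaryTree ℕ} :
    T ∈ validSpines m k ↔ ∃ B : BDD k (Fin m), B.spine = T := by
  simp [validSpines]

theorem numBDD_eq_sum {n k : ℕ} (hk : 1 ≤ k) :
    numBDD n k = ∑ T ∈ validSpines (n - 2) k, treeWeight T [] := by
  classical
  set m := n - 2
  have hch : ∀ T : validSpines m k, ∃ B : BDD k (Fin m), B.spine = T.1 :=
    fun T => mem_validSpines_iff_exists.1 T.2
  choose rep hrep using hch
  -- One labelled tree is fixed for each spine. By rigidity and transport, every isomorphism class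
  -- has exactly one member on the labelled tree of its spine.
  let A : validSpines m k → Set (BDD k (Fin m)) :=
    fun T => {C | C.idx = (rep T).idx ∧ C.dfsTree = (rep T).dfsTree}
  have hA : ∀ T, Nat.card (A T) = treeWeight T.1 [] := by
    intro T
    rw [Nat.card_coe_set_eq, BDD.ncard_dfsTree_eq (rep T).dfsTree_nodup (rep T).mem_dfsTree
      ((rep T).hasRoot_spine hk) (rep T).layered_spine, ← BDD.spine, hrep]
  have hspine : ∀ T (C : A T), C.1.spine = T.1 := by
    rintro T ⟨C, h1, h2⟩
    change C.dfsTree.map C.idx = _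
    rw [← hrep, BDD.spine, h1, h2]
  let F : (Σ T, A T) → Quotient (BDD.isoSetoid k m) := fun x => Quotient.mk _ x.2.1
  have hF : Function.Bijective F := by
    constructor
    · rintro ⟨T, C⟩ ⟨T', C'⟩ h
      have hiso : C.1.Iso C'.1 := Quotient.exact h
      have hT : T = T' := Subtype.ext (by rw [← hspine T C, ← hspine T' C', hiso.spine_eq])
      subst hT
      have : C = C' := Subtype.ext (BDD.eq_of_iso hiso (C.2.2.trans C'.2.2.symm))
      rw [this]
    · intro q
      obtain ⟨B, rfl⟩ := Quotient.exists_rep q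
      let T : validSpines m k := ⟨B.spine, mem_validSpines_iff_exists.2 ⟨B, rfl⟩⟩
      obtain ⟨D, h1, h2, h3⟩ := BDD.exists_iso_of_spine_eq hk (B := B) (C := rep T)
        (hrep T).symm
      exact ⟨⟨T, D, h2, h3⟩, Quotient.sound h1.symm⟩
  rw [numBDD, ← Nat.card_congr (Equiv.ofBijective F hF), Nat.card_sigma,
    Finset.sum_congr rfl fun T _ => hA T, Finset.univ_eq_attach,
    Finset.sum_attach _ fun T => treeWeight T []]

theorem mem_validSpines_iff {m k : ℕ} (hk : 1 ≤ k) {T : BinaryTree ℕ} :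
    T ∈ validSpines m k ↔ (preorderList T).length = m ∧ HasRoot k T ∧ Layered (k + 1) T ∧
      0 < treeWeight T [] := by
  rw [mem_validSpines_iff_exists]
  constructor
  · rintro ⟨B, rfl⟩
    refine ⟨?_, B.hasRoot_spine hk, B.layered_spine, B.treeWeight_spine_pos hk⟩
    have huniv : Finset.univ = (preorderList B.dfsTree).toFinset := by
      ext v; simp [B.mem_dfsTree v]
    rw [BDD.spine, preorderList_map, List.length_map,
      ← List.toFinset_card_of_nodup B.dfsTree_nodup, ← huniv, Finset.card_fin]
  · rintro ⟨h1, h2, h3, h4⟩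
    obtain ⟨t, ht, hs⟩ := exists_preorderList_eq T (List.finRange m) (by simp [h1])
    have hnd : (preorderList t).Nodup := by rw [ht]; exact List.nodup_finRange m
    have hcov : ∀ v, v ∈ preorderList t := by intro v; rw [ht]; exact List.mem_finRange v
    obtain ⟨idx, rfl⟩ := exists_map_eq hs hnd
    have := BDD.ncard_dfsTree_eq hnd hcov h2 h3
    rw [← this, Set.ncard_pos (Set.toFinite _)] at h4
    obtain ⟨B, rfl, rfl⟩ := h4
    exact ⟨B, rfl⟩

theorem BDD.spineWeight_spine {m k : ℕ} (hk : 1 ≤ k) (B : BDD k (Fin m)) :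
    spineWeight m k B.spine = treeWeight B.spine [] := by
  have : {c | ∃ C : BDD k (Fin m), C.spine = B.spine ∧ C.cumulatedWeight = c} =
      {treeWeight B.spine []} := by
    ext c
    constructor
    · rintro ⟨C, h, rfl⟩
      rw [C.cumulatedWeight_eq hk, h]
      rfl
    · rintro rfl
      exact ⟨B, rfl, B.cumulatedWeight_eq hk⟩
  rw [spineWeight, this, csSup_singleton]

theorem spineWeight_eq {m k : ℕ} (hk : 1 ≤ k) {T : BinaryTree ℕ} (hT : T ∈ validSpines m k) :
    spineWeight m k T = treeWeight T [] := by
  obtain ⟨B, rfl⟩ := mem_validSpines_iff_exists.1 hT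
  exact B.spineWeight_spine hk

/-! ### The algorithm without monads -/

/-- The union of the arrays for the subtrees with root index `1, …, k - 1`. -/
def childFold (call : List ℕ → ℕ → WeightDict) (p : List ℕ) : WeightDict :=
  (List.range' 1 (p.length - 1)).foldl (fun d j => d ∪ call (p.take j) (p.getD j 0)) ∅

/-- The array for the subtrees of size `m`, where the empty subtree has weight `w₀`. -/
def subDict (call : ℕ → List ℕ → ℕ → WeightDict) (m : ℕ) (w₀ : ℤ) (p : List ℕ) : WeightDict :=
  if m = 0 then AList.singleton [] w₀ else childFold (call m) p

/-- The contribution of a pair of entries for the left and the right subtree. -/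
def addPair (n : ℕ) (k s : ℕ) (e₀ : Sigma fun _ : List ℕ => ℤ) (d : WeightDict)
    (e₁ : Sigma fun _ : List ℕ => ℤ) : WeightDict :=
  let w : ℤ := if n = 1 then e₀.2 * e₁.2 - (s : ℤ) else e₀.2 * e₁.2
  if 0 < w then WeightDict.addWeight d (addLists (addLists e₀.1 e₁.1) (unitList k)) w else d

/-- The body of the algorithm as an iterated fold. -/
def countFold (n : ℕ) (p : List ℕ) (s : ℕ) (call : ℕ → List ℕ → ℕ → WeightDict) : WeightDict :=
  (List.finRange n).foldl (fun d i =>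
    (subDict call i.val (p.sum : ℤ) p).entries.foldl (fun d e₀ =>
      (subDict call (n - 1 - i.val) (-1 + ((addLists p e₀.1).sum : ℤ))
        (addLists p e₀.1)).entries.foldl (addPair n p.length s e₀) d) d) ∅

section Monadic

variable {M : Type → Type} [Monad M] {R : ∀ {α : Type}, M α → α → Prop}

theorem foldlM_rel (hpure : ∀ {α : Type} (a : α), R (pure a : M α) a)
    (hbind : ∀ {α β : Type} {x : M α} {a : α} {f : α → M β} {b : β},
      R x a → R (f a) b → R (x >>= f) b)
    {α β : Type} {f : β → α → M β} {g : β → α → β} (h : ∀ b x, R (f b x) (g b x)) (l : List α)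
    (b : β) : R (l.foldlM f b) (l.foldl g b) := by
  induction l generalizing b with
  | nil => exact hpure b
  | cons x l ih =>
    rw [List.foldlM_cons, List.foldl_cons]
    exact hbind (h b x) (ih _)

/-- Read `R x a` as "the program `x` computes `a`". Only compatibility with `pure` and `bind` is
needed, so `Id` and the state monad of the memoized version are instances of one argument. -/
theorem countBody_rel (hpure : ∀ {α : Type} (a : α), R (pure a : M α) a)
    (hbind : ∀ {α β : Type} {x : M α} {a : α} {f : α → M β} {b : β},
      R x a → R (f a) b → R (x >>= f) b)
    (n : ℕ) (p : List ℕ) (s : ℕ) {call : (m : ℕ) → m < n → List ℕ → ℕ → M WeightDict}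
    {call' : ℕ → List ℕ → ℕ → WeightDict} (h : ∀ m hm p' s', R (call m hm p' s') (call' m p' s')) :
    R (countBody n p s call) (countFold n p s call') := by
  have hchild : ∀ m (hm : m < n) p', R (childDict (call m hm) p') (childFold (call' m) p') :=
    fun m hm p' => by
      unfold childDict childFold
      apply foldlM_rel hpure hbind
      intro d j
      exact hbind (h m hm _ _) (hpure _)
  have hsub : ∀ m (hm : m < n) (w₀ : ℤ) p' {β : Type} {f : WeightDict → M β} {b : β},
      R (f (subDict call' m w₀ p')) b →
      R (if m = 0 then pure (AList.singleton [] w₀) >>= f else childDict (call m hm) p' >>= f)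
        b := by
    intro m hm w₀ p' β f b hf
    unfold subDict at hf
    split_ifs with h0
    · rw [if_pos h0] at hf
      exact hbind (hpure _) hf
    · rw [if_neg h0] at hf
      exact hbind (hchild m hm p') hf
  unfold countBody countFold
  apply foldlM_rel hpure hbind
  intro d i
  dsimp only
  apply hsub _ i.isLt
  apply foldlM_rel hpure hbind
  intro d e₀
  apply hsub _ (by have := i.isLt; omega)
  exact hpure _

end Monadic

theorem count_eq (n : ℕ) (p : List ℕ) (s : ℕ) : count n p s = countFold n p s count := by
  rw [count]
  exact countBody_rel (M := Id) (R := fun x a => Id.run x = a) (fun _ => rfl)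
    (fun h h' => by subst h; exact h') n p s (fun _ _ _ _ => rfl)

/-! ### Memoization -/

/-- Started with a table of correct results, the computation `x` returns `a` and leaves a table of
correct results. -/
def Computes {α : Type} (x : StateM MemoTable α) (a : α) : Prop :=
  ∀ table : MemoTable,
    (∀ n p s d, table.lookup (n, p, s) = some d → d = count n p s) →
    (x.run table).run.1 = a ∧
      ∀ n p s d, (x.run table).run.2.lookup (n, p, s) = some d → d = count n p s

theorem Computes.bind {α β : Type} {x : StateM MemoTable α} {a : α} {f : α → StateM MemoTable β}
    {b : β} (h : Computes x a) (h' : Computes (f a) b) : Computes (x >>= f) b := by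
  intro table ht
  obtain ⟨h1, h2⟩ := h table ht
  have := h' _ h2
  rw [← h1] at this
  exact this

/-- The invariant is that the table holds only correct results. A lookup then returns a correct
value, and a new entry preserves the invariant. -/
theorem computes_countMemo (n : ℕ) (p : List ℕ) (s : ℕ) :
    Computes (countMemo n p s) (count n p s) := by
  induction n using Nat.strong_induction_on generalizing p s with
  | _ n ih =>
    intro table ht
    rw [countMemo]
    have hget : ∀ f : MemoTable → StateM MemoTable WeightDict,
        ((get >>= f).run table).run = ((f table).run table).run := fun _ => rfl
    rw [hget]
    cases hl : table.lookup (n, p, s) with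
    | some d => exact ⟨ht _ _ _ _ hl, ht⟩
    | none =>
      have hbody : Computes (countBody n p s fun m _ p' s' => countMemo m p' s') (count n p s) := by
        rw [count_eq]
        exact countBody_rel (R := Computes) (fun _ _ ht => ⟨rfl, ht⟩) Computes.bind n p s
          (fun m hm p' s' => ih m hm p' s')
      refine hbody.bind (a := count n p s) (b := count n p s) ?_ table ht
      intro table' ht'
      refine ⟨rfl, fun n' p' s' d h => ?_⟩
      change (table'.insert (n, p, s) (count n p s)).lookup (n', p', s') = some d at h
      by_cases he : (n', p', s') = (n, p, s)
      · obtain ⟨rfl, rfl, rfl⟩ : n' = n ∧ p' = p ∧ s' = s := by simpa using he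
        rw [AList.lookup_insert] at h
        exact (Option.some.inj h).symm
      · rw [AList.lookup_insert_ne he] at h
        exact ht' _ _ _ _ h

theorem run'_countMemo (n : ℕ) (p : List ℕ) (s : ℕ) :
    (StateT.run' (countMemo n p s) ∅ : Id WeightDict).run = count n p s :=
  (computes_countMemo n p s ∅ (by simp)).1

/-! ### Sums over associative arrays -/

namespace WeightDict

/-- The sum of `w * f t` over the entries `(t, w)`. -/
def weightedSum (d : WeightDict) (f : List ℕ → ℤ) : ℤ :=
  (d.entries.map fun e => e.2 * f e.1).sum

/-- All values are positive. -/
def Pos (d : WeightDict) : Prop := ∀ e ∈ d.entries, 0 < e.2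

theorem weightedSum_insert_of_notMem {d : WeightDict} {t : List ℕ} (h : t ∉ d) (w : ℤ)
    (f : List ℕ → ℤ) : weightedSum (d.insert t w) f = w * f t + weightedSum d f := by
  rw [weightedSum, AList.entries_insert_of_notMem h, List.map_cons, List.sum_cons, weightedSum]

/-- Whether or not the key exists, the functional grows by the same term; from here on the case
distinction disappears. -/
theorem weightedSum_addWeight (d : WeightDict) (t : List ℕ) (w : ℤ) (f : List ℕ → ℤ) :
    weightedSum (d.addWeight t w) f = weightedSum d f + w * f t := by
  unfold addWeight
  cases hl : d.lookup t with
  | none =>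
    simp only
    rw [weightedSum_insert_of_notMem (AList.lookup_eq_none.1 hl), add_comm]
  | some w' =>
    have ht : t ∈ d.entries.keys := AList.lookup_isSome.1 (by rw [hl]; rfl)
    obtain ⟨b, l₁, l₂, h1, h2, h3⟩ := List.exists_of_kerase ht
    have hb : b = w' := by
      have : (⟨t, b⟩ : Sigma fun _ : List ℕ => ℤ) ∈ d.entries := by rw [h2]; simp
      rw [← AList.mem_lookup_iff, hl] at this
      exact (Option.some.inj this).symm
    subst hb
    simp only
    rw [weightedSum, AList.entries_insert, h3, weightedSum, h2]
    simp
    ring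

theorem Pos.addWeight {d : WeightDict} (hd : d.Pos) {t : List ℕ} {w : ℤ} (hw : 0 < w) :
    (d.addWeight t w).Pos := by
  unfold WeightDict.addWeight
  have hins : ∀ w : ℤ, 0 < w → Pos (d.insert t w) := by
    intro w hw e he
    rw [AList.entries_insert, List.mem_cons] at he
    rcases he with rfl | he
    · exact hw
    · exact hd e ((List.kerase_sublist _ _).subset he)
  cases hl : d.lookup t with
  | none => exact hins w hw
  | some w' =>
    exact hins _ (add_pos (hd ⟨t, w'⟩ (AList.mem_lookup_iff.1 hl)) hw)

theorem kunion_of_disjoint {l₁ l₂ : List (Sigma fun _ : List ℕ => ℤ)}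
    (h : ∀ t ∈ l₁.keys, t ∉ l₂.keys) : List.kunion l₁ l₂ = l₁ ++ l₂ := by
  induction l₁ generalizing l₂ with
  | nil => rfl
  | cons e l ih =>
    rw [List.kunion_cons, List.kerase_of_notMem_keys (h e.1 (by simp)),
      ih fun t ht => h t (by simp [ht]), List.cons_append]

theorem entries_union_of_disjoint {d d' : WeightDict} (h : ∀ t ∈ d, t ∉ d') :
    (d ∪ d').entries = d.entries ++ d'.entries := by
  rw [AList.union_entries]
  exact kunion_of_disjoint h

theorem weightedSum_indicator (d : WeightDict) (t : List ℕ) :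
    d.weightedSum (fun t' => if t' = t then 1 else 0) = (d.lookup t).getD 0 := by
  obtain ⟨l, hl⟩ := d
  unfold weightedSum AList.lookup
  simp only
  induction l with
  | nil => rfl
  | cons e l ih =>
    rw [List.nodupKeys_cons] at hl
    rw [List.map_cons, List.sum_cons, ih hl.2]
    by_cases he : e.1 = t
    · subst he
      rw [List.dlookup_eq_none.2 hl.1, List.dlookup_cons_eq]
      simp
    · rw [if_neg he, List.dlookup_cons_ne _ _ (Ne.symm he), mul_zero, zero_add]

/-- A missing key contributes `0` and a present one a positive number, so the functional determines
the keys as well as the values. -/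
theorem Pos.lookup_eq_some_iff {d : WeightDict} (hd : d.Pos) {t : List ℕ} {w : ℤ} :
    d.lookup t = some w ↔ 0 < w ∧ w = d.weightedSum fun t' => if t' = t then 1 else 0 := by
  rw [weightedSum_indicator]
  constructor
  · intro h
    exact ⟨hd ⟨t, w⟩ (AList.mem_lookup_iff.1 h), by rw [h]; rfl⟩
  · rintro ⟨h1, h2⟩
    cases hl : d.lookup t with
    | none => rw [hl] at h2; simp at h2; omega
    | some w' => rw [hl] at h2; rw [h2]; rfl

theorem foldl_spec {α : Type} {g : WeightDict → α → WeightDict} {f : List ℕ → ℤ} {h : α → ℤ}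
    {l : List α} (hg : ∀ d x, x ∈ l → Pos d →
      Pos (g d x) ∧ weightedSum (g d x) f = weightedSum d f + h x) {d : WeightDict} (hd : Pos d) :
    Pos (l.foldl g d) ∧ weightedSum (l.foldl g d) f = weightedSum d f + (l.map h).sum := by
  induction l generalizing d with
  | nil => simpa using hd
  | cons x l ih =>
    obtain ⟨h1, h2⟩ := hg d x (by simp) hd
    obtain ⟨h3, h4⟩ := ih (fun d y hy => hg d y (by simp [hy])) h1
    refine ⟨h3, ?_⟩
    rw [List.foldl_cons, h4, h2, List.map_cons, List.sum_cons, add_assoc]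

end WeightDict

/-! ### Profiles -/

theorem length_addLists (l r : List ℕ) : (addLists l r).length = max l.length r.length := by
  induction l generalizing r with
  | nil => simp [addLists]
  | cons a l ih =>
    cases r with
    | nil => simp [addLists]
    | cons b r => simp [addLists, ih, Nat.succ_max_succ]

theorem getD_addLists (l r : List ℕ) (j : ℕ) :
    (addLists l r).getD j 0 = l.getD j 0 + r.getD j 0 := by
  induction l generalizing r j with
  | nil => simp [addLists]
  | cons a l ih =>
    cases r with
    | nil => simp [addLists]
    | cons b r =>
      cases j with
      | zero => simp [addLists]
      | succ j => simpa [addLists] using ih r j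

theorem ext_getD {l r : List ℕ} (h : l.length = r.length)
    (h' : ∀ j < l.length, l.getD j 0 = r.getD j 0) : l = r := by
  refine List.ext_getElem h fun j h1 h2 => ?_
  have := h' j h1
  rwa [List.getD_eq_getElem _ _ h1, List.getD_eq_getElem _ _ h2] at this

theorem getD_unitList (k j : ℕ) : (unitList k).getD j 0 = if j = k then 1 else 0 := by
  unfold unitList
  rcases lt_trichotomy j k with h | h | h
  · rw [List.getD_append _ _ _ _ (by simpa using h), if_neg h.ne]
    simp
  · subst h
    rw [List.getD_append_right _ _ _ _ (by simp)]
    simp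
  · rw [if_neg h.ne', List.getD_eq_default]
    simp only [List.length_append, List.length_replicate, List.length_singleton]
    omega

theorem le_foldr_max {L : List ℕ} {j : ℕ} (h : j ∈ L) : j ≤ L.foldr max 0 := by
  induction L with
  | nil => simp at h
  | cons a L ih =>
    rw [List.foldr_cons]
    rcases List.mem_cons.1 h with rfl | h
    · exact le_max_left _ _
    · exact (ih h).trans (le_max_right _ _)

theorem foldr_max_le {L : List ℕ} {b : ℕ} (h : ∀ j ∈ L, j ≤ b) : L.foldr max 0 ≤ b := by
  induction L with
  | nil => exact Nat.zero_le _
  | cons a L ih =>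
    rw [List.foldr_cons]
    exact max_le (h a (by simp)) (ih fun j hj => h j (by simp [hj]))

theorem getD_treeProfile (T : BinaryTree ℕ) (j : ℕ) :
    (treeProfile T).getD j 0 = (preorderList T).count j := by
  unfold treeProfile profileOfIndices
  split_ifs with h
  · simp [h]
  · by_cases hj : j < (preorderList T).foldr max 0 + 1
    · rw [List.getD_eq_getElem _ _ (by simpa using hj)]
      simp
    · rw [List.getD_eq_default _ _ (by simpa using hj), List.count_eq_zero_of_not_mem]
      intro hm
      have := le_foldr_max hm
      omega

theorem Layered.length_treeProfile_le {b : ℕ} {T : BinaryTree ℕ} (h : Layered b T) :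
    (treeProfile T).length ≤ b := by
  unfold treeProfile profileOfIndices
  split_ifs with h'
  · exact Nat.zero_le _
  · rw [List.length_map, List.length_range]
    obtain ⟨j, hj⟩ := List.exists_mem_of_ne_nil _ h'
    have h1 := (h.lt j hj).2
    have := foldr_max_le (L := preorderList T) (b := b - 1) fun j hj => by
      have := (h.lt j hj).2
      omega
    omega

theorem Layered.length_treeProfile_node {k : ℕ} {l r : BinaryTree ℕ}
    (h : Layered (k + 1) (.node k l r)) : (treeProfile (.node k l r)).length = k + 1 := by
  refine le_antisymm h.length_treeProfile_le ?_
  unfold treeProfile profileOfIndices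
  rw [if_neg (by simp [preorderList]), List.length_map, List.length_range]
  have := le_foldr_max (L := preorderList (.node k l r)) (j := k) (by simp [preorderList])
  omega

/-- The root label exceeds all labels below it, so the unit list fixes the length of the sum. -/
theorem treeProfile_node {k : ℕ} {l r : BinaryTree ℕ} (h : Layered (k + 1) (.node k l r)) :
    addLists (addLists (treeProfile l) (treeProfile r)) (unitList k) =
      treeProfile (.node k l r) := by
  obtain ⟨-, -, hl, hr⟩ := id h
  refine ext_getD ?_ fun j _ => ?_
  · rw [length_addLists, length_addLists, h.length_treeProfile_node]
    have h1 := hl.length_treeProfile_le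
    have h2 := hr.length_treeProfile_le
    simp only [unitList, List.length_append, List.length_replicate, List.length_singleton]
    omega
  · rw [getD_addLists, getD_addLists, getD_unitList, getD_treeProfile, getD_treeProfile,
      getD_treeProfile, preorderList, List.count_cons, List.count_append]
    by_cases hj : j = k
    · subst hj; simp
    · simp [hj, Ne.symm hj]

/-- The pool profile of a node of index `k` if `S` lists the indices of the nodes that come
before. -/
def poolList (k : ℕ) (S : List ℕ) : List ℕ :=
  (List.range k).map fun j => (if j = 0 then 2 else 0) + S.count j

theorem length_poolList (k : ℕ) (S : List ℕ) : (poolList k S).length = k := by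
  simp [poolList]

theorem getD_poolList {j k : ℕ} (hj : j < k) (S : List ℕ) :
    (poolList k S).getD j 0 = (if j = 0 then 2 else 0) + S.count j := by
  rw [List.getD_eq_getElem _ _ (by rwa [length_poolList])]
  simp [poolList]

theorem take_poolList {j k : ℕ} (hj : j ≤ k) (S : List ℕ) :
    (poolList k S).take j = poolList j S := by
  rw [poolList, ← List.map_take, List.take_range, min_eq_left hj, poolList]

theorem poolList_congr {k : ℕ} {S S' : List ℕ} (h : ∀ j < k, S.count j = S'.count j) :
    poolList k S = poolList k S' :=
  List.map_congr_left fun j hj => by rw [h j (List.mem_range.1 hj)]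

/-- The two sinks are counted in component `0`, which is present because `k ≥ 1`. -/
theorem sum_poolList {k : ℕ} (hk : 1 ≤ k) (S : List ℕ) : (poolList k S).sum = poolSize k S := by
  have hstep : ∀ m, S.countP (· < m + 1) = S.countP (· < m) + S.count m := by
    intro m
    induction S with
    | nil => rfl
    | cons a S ih =>
      rw [List.countP_cons, List.countP_cons, List.count_cons, ih]
      simp only [decide_eq_true_eq, beq_iff_eq]
      split_ifs <;> omega
  induction k, hk using Nat.le_induction with
  | base =>
    have := hstep 0
    simp only [poolList, poolSize, List.range_one, List.map_singleton, List.sum_singleton]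
    simp at this ⊢
    exact this.symm
  | succ k hk ih =>
    rw [poolList, List.range_succ, List.map_append, List.sum_append, ← poolList, ih, poolSize,
      poolSize, hstep]
    simp only [List.map_singleton, List.sum_singleton]
    rw [if_neg (by omega)]
    omega

theorem addLists_poolList {k : ℕ} {T : BinaryTree ℕ} (h : Layered k T) (S : List ℕ) :
    addLists (poolList k S) (treeProfile T) = poolList k (S ++ preorderList T) := by
  have hl : (addLists (poolList k S) (treeProfile T)).length = k := by
    rw [length_addLists, length_poolList, max_eq_left h.length_treeProfile_le]
  refine ext_getD (by rw [hl, length_poolList]) fun j hj => ?_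
  rw [hl] at hj
  rw [getD_addLists, getD_poolList hj, getD_poolList hj, getD_treeProfile, List.count_append]
  omega

theorem rootPool_eq_poolList {k : ℕ} (hk : 1 ≤ k) : rootPool k = poolList k [] := by
  obtain ⟨k, rfl⟩ := Nat.exists_eq_add_of_le' hk
  simp [rootPool, poolList, List.range_succ_eq_map]
  symm
  rw [List.eq_replicate_iff]
  simp

/-! ### The arrays returned by the algorithm -/

theorem finite_layered (b : ℕ) : {T | Layered b T}.Finite := by
  induction b with
  | zero =>
    refine (Set.finite_singleton BinaryTree.nil).subset fun T hT => ?_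
    cases T with
    | nil => rfl
    | node k l r => exact absurd hT.2.1 (Nat.not_lt_zero _)
  | succ b ih =>
    refine ((Set.finite_singleton BinaryTree.nil).union (((Set.finite_Iic b).prod
      (ih.prod ih)).image fun x => BinaryTree.node x.1 x.2.1 x.2.2)).subset fun T hT => ?_
    cases T with
    | nil => exact .inl rfl
    | node k l r =>
      obtain ⟨-, h2, h3, h4⟩ := hT
      have hk : k ≤ b := Nat.lt_succ_iff.1 h2
      exact .inr ⟨(k, l, r), ⟨hk, h3.mono hk, h4.mono hk⟩, rfl⟩

open Classical in
/-- The layered trees with `m` nodes and labels smaller than `k`. -/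
noncomputable def subTrees (m k : ℕ) : Finset (BinaryTree ℕ) :=
  (finite_layered k).toFinset.filter fun T => (preorderList T).length = m

open Classical in
/-- The layered trees with `m` nodes and root label `k`. -/
noncomputable def rootedTrees (m k : ℕ) : Finset (BinaryTree ℕ) :=
  (subTrees m (k + 1)).filter fun T => HasRoot k T

theorem mem_subTrees {m k : ℕ} {T : BinaryTree ℕ} :
    T ∈ subTrees m k ↔ Layered k T ∧ (preorderList T).length = m := by
  simp [subTrees]

theorem mem_rootedTrees {m k : ℕ} {T : BinaryTree ℕ} :
    T ∈ rootedTrees m k ↔ (Layered (k + 1) T ∧ (preorderList T).length = m) ∧ HasRoot k T := by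
  simp [rootedTrees, mem_subTrees]

theorem subTrees_zero (k : ℕ) : subTrees 0 k = {.nil} := by
  ext T
  rw [mem_subTrees, Finset.mem_singleton]
  cases T with
  | nil => simp [Layered, preorderList]
  | node a l r => simp [preorderList]

theorem subTrees_one {m : ℕ} (hm : m ≠ 0) : subTrees m 1 = ∅ := by
  ext T
  rw [mem_subTrees]
  cases T with
  | nil => simpa [preorderList] using fun _ => hm.symm
  | node a l r =>
    simp only [Layered, Finset.notMem_empty, iff_false]
    omega

theorem sum_subTrees_succ (m k : ℕ) (G : BinaryTree ℕ → ℤ) :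
    ∑ T ∈ subTrees m (k + 1), G T = ∑ T ∈ subTrees m k, G T + ∑ T ∈ rootedTrees m k, G T := by
  classical
  rw [← Finset.sum_filter_add_sum_filter_not (subTrees m (k + 1)) (fun T => ¬ HasRoot k T)]
  congr 1
  · refine Finset.sum_congr ?_ fun _ _ => rfl
    ext T
    rw [Finset.mem_filter, mem_subTrees, mem_subTrees]
    cases T with
    | nil => simp [Layered, preorderList, HasRoot]
    | node a l r =>
      simp only [Layered, HasRoot]
      constructor
      · rintro ⟨⟨⟨h1, h2, h3⟩, h4⟩, h5⟩
        exact ⟨⟨h1, by omega, h3⟩, h4⟩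
      · rintro ⟨⟨h1, h2, h3⟩, h4⟩
        exact ⟨⟨⟨h1, by omega, h3⟩, h4⟩, by omega⟩
  · refine Finset.sum_congr ?_ fun _ _ => rfl
    ext T
    simp [rootedTrees]

theorem sum_rootedTrees {n k : ℕ} (hk : 1 ≤ k) (G : BinaryTree ℕ → ℤ) :
    ∑ T ∈ rootedTrees n k, G T = ∑ i : Fin n, ∑ l ∈ subTrees i k,
      ∑ r ∈ subTrees (n - 1 - i) k, G (.node k l r) := by
  simp only [Finset.sum_sigma']
  symm
  refine Finset.sum_bij (fun x _ => .node k x.2.1 x.2.2) ?_ ?_ ?_ fun _ _ => rfl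
  · rintro ⟨i, l, r⟩ h
    simp only [Finset.mem_sigma, Finset.mem_univ, true_and, mem_subTrees] at h
    obtain ⟨⟨h1, h2⟩, h3, h4⟩ := h
    rw [mem_rootedTrees]
    refine ⟨⟨⟨hk, Nat.lt_succ_self k, h1, h3⟩, ?_⟩, rfl⟩
    have := i.isLt
    simp only [preorderList, List.length_cons, List.length_append, h2, h4]
    omega
  · rintro ⟨i, l, r⟩ h ⟨i', l', r'⟩ h' e
    simp only [Finset.mem_sigma, Finset.mem_univ, true_and, mem_subTrees] at h h'
    simp only [BinaryTree.node.injEq, true_and] at e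
    obtain ⟨rfl, rfl⟩ := e
    obtain rfl : i = i' := Fin.ext (h.1.2.symm.trans h'.1.2)
    rfl
  · intro T hT
    rw [mem_rootedTrees] at hT
    obtain ⟨⟨h1, h2⟩, h3⟩ := hT
    cases T with
    | nil => exact h3.elim
    | node a l r =>
      obtain rfl : a = k := h3
      obtain ⟨-, -, h4, h5⟩ := h1
      simp only [preorderList, List.length_cons, List.length_append] at h2
      refine ⟨⟨⟨(preorderList l).length, by omega⟩, l, r⟩, ?_, rfl⟩
      simp only [Finset.mem_sigma, Finset.mem_univ, true_and, mem_subTrees]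
      exact ⟨⟨h4, trivial⟩, h5, by omega⟩

/-! ### Arrays as weighted sums over trees -/

/-- The array `d` maps each profile to the sum of the weights `wt T` of the trees `T` in `F` with
this profile. -/
structure Represents (d : WeightDict) (F : Finset (BinaryTree ℕ)) (wt : BinaryTree ℕ → ℤ) :
    Prop where
  pos : d.Pos
  sum_eq : ∀ f, d.weightedSum f = ∑ T ∈ F, wt T * f (treeProfile T)

theorem Represents.exists_of_mem {d : WeightDict} {F : Finset (BinaryTree ℕ)}
    {wt : BinaryTree ℕ → ℤ} (h : Represents d F wt) {t : List ℕ} (ht : t ∈ d) :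
    ∃ T ∈ F, treeProfile T = t := by
  obtain ⟨w, hw⟩ := Option.isSome_iff_exists.1 (AList.lookup_isSome.2 ht)
  obtain ⟨h1, h2⟩ := h.pos.lookup_eq_some_iff.1 hw
  rw [h.sum_eq] at h2
  obtain ⟨T, hT, hne⟩ := Finset.exists_ne_zero_of_sum_ne_zero (h2 ▸ h1.ne')
  refine ⟨T, hT, ?_⟩
  by_contra hp
  exact hne (by rw [if_neg hp, mul_zero])

theorem represents_singleton {w : ℤ} (hw : 0 < w) (k : ℕ) {wt : BinaryTree ℕ → ℤ}
    (hwt : wt .nil = w) : Represents (AList.singleton [] w) (subTrees 0 k) wt where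
  pos := by
    intro e he
    rw [AList.singleton_entries, List.mem_singleton] at he
    rw [he]
    exact hw
  sum_eq f := by
    rw [subTrees_zero, Finset.sum_singleton, hwt, WeightDict.weightedSum, AList.singleton_entries]
    simp [treeProfile, profileOfIndices, preorderList]

/-- The result of `count m` for all arguments that come from partial spines. -/
def CountSpec (m : ℕ) : Prop :=
  ∀ k S, 1 ≤ k → Represents (count m (poolList k S) (S.count k)) (rootedTrees m k)
    fun T => treeWeight T S

/-- The pool lists only counts below `k`, so it cannot distinguish `S` from the true list `S'`,
which also contains the parent of index `k`. The union of arrays loses nothing: a profile has length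
one more than the root label, so different root labels give disjoint keys. -/
theorem represents_childFold {m k : ℕ} (hm : m ≠ 0) (hk : 1 ≤ k) (h : CountSpec m)
    {S S' : List ℕ} (hS : ∀ j < k, S.count j = S'.count j) :
    Represents (childFold (count m) (poolList k S)) (subTrees m k) fun T => treeWeight T S' := by
  unfold childFold
  rw [length_poolList]
  have key : ∀ c, c + 1 ≤ k → Represents ((List.range' 1 c).foldl
      (fun d j => d ∪ count m ((poolList k S).take j) ((poolList k S).getD j 0)) ∅)
      (subTrees m (c + 1)) fun T => treeWeight T S' := by
    intro c
    induction c with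
    | zero =>
      intro _
      refine ⟨fun e he => by simp at he, fun f => ?_⟩
      rw [subTrees_one hm]
      rfl
    | succ c ih =>
      intro hc
      have ih := ih (by omega)
      have hcall : count m ((poolList k S).take (1 + c)) ((poolList k S).getD (1 + c) 0) =
          count m (poolList (c + 1) S') (S'.count (c + 1)) := by
        rw [add_comm 1 c, take_poolList (by omega), getD_poolList (by omega), if_neg (by omega),
          zero_add, hS _ (by omega), poolList_congr fun j hj => hS j (by omega)]
      rw [List.range'_concat, List.foldl_append, List.foldl_cons, List.foldl_nil, one_mul, hcall]
      generalize (List.range' 1 c).foldl (fun d j =>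
        d ∪ count m ((poolList k S).take j) ((poolList k S).getD j 0)) ∅ = d at ih
      have hnew := h (c + 1) S' (by omega)
      generalize count m (poolList (c + 1) S') (S'.count (c + 1)) = d' at hnew
      have hdisj : ∀ t ∈ d, t ∉ d' := by
        intro t ht ht'
        obtain ⟨T, hT, hTt⟩ := ih.exists_of_mem ht
        obtain ⟨T', hT', hTt'⟩ := hnew.exists_of_mem ht'
        rw [mem_subTrees] at hT
        rw [mem_rootedTrees] at hT'
        have h1 := hT.1.length_treeProfile_le
        have h2 : (treeProfile T').length = c + 1 + 1 := by
          cases T' with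
          | nil => exact hT'.2.elim
          | node a l r =>
            obtain rfl : a = c + 1 := hT'.2
            exact hT'.1.1.length_treeProfile_node
        rw [hTt] at h1
        rw [hTt'] at h2
        omega
      have hent := WeightDict.entries_union_of_disjoint hdisj
      refine ⟨fun e he => ?_, fun f => ?_⟩
      · rw [hent] at he
        exact (List.mem_append.1 he).elim (ih.pos e) (hnew.pos e)
      · rw [sum_subTrees_succ, ← ih.sum_eq, ← hnew.sum_eq, WeightDict.weightedSum,
          hent, List.map_append, List.sum_append]
        rfl
  have := key (k - 1) (by omega)
  rwa [Nat.sub_add_cancel hk] at this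

theorem represents_subDict {m k : ℕ} (hk : 1 ≤ k) (h : m ≠ 0 → CountSpec m) {w₀ : ℤ}
    (hw₀ : 0 < w₀) {S S' : List ℕ} (hS : ∀ j < k, S.count j = S'.count j) :
    Represents (subDict count m w₀ (poolList k S)) (subTrees m k)
      fun T => if T = .nil then w₀ else treeWeight T S' := by
  unfold subDict
  split_ifs with hm
  · subst hm
    exact represents_singleton hw₀ k (if_pos rfl)
  · have := represents_childFold hm hk (h hm) hS
    refine ⟨this.pos, fun f => ?_⟩
    rw [this.sum_eq]
    refine Finset.sum_congr rfl fun T hT => ?_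
    rw [if_neg]
    rintro rfl
    exact hm (mem_subTrees.1 hT).2.symm

theorem two_le_poolSize (k : ℕ) (S : List ℕ) : 2 ≤ poolSize k S := Nat.le_add_right _ _

/-- The weights combined by the algorithm give the weight of the whole tree. -/
theorem cast_treeWeight_node {k : ℕ} {S : List ℕ} {l r : BinaryTree ℕ} :
    (treeWeight (.node k l r) S : ℤ) =
      -- The maximum with `0` reflects both the truncated subtraction in `ownWeight` and the test `w
      -- > 0` of the algorithm.
      if l = .nil ∧ r = .nil then
        max ((poolSize k S : ℤ) * (-1 + (poolSize k (S ++ preorderList l) : ℤ)) - S.count k) 0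
      else (if l = .nil then (poolSize k S : ℤ) else treeWeight l (S ++ [k])) *
        (if r = .nil then -1 + (poolSize k (S ++ preorderList l) : ℤ)
          else treeWeight r (S ++ [k] ++ preorderList l)) := by
  have h2 := two_le_poolSize k S
  have h2' := two_le_poolSize k (S ++ preorderList l)
  cases l with
  | nil =>
    cases r with
    | nil =>
      simp only [treeWeight, ownWeight, preorderList, List.append_nil, mul_one, and_self, if_true]
      have : ((poolSize k S : ℤ) * (-1 + (poolSize k S : ℤ))) =
          ((poolSize k S * (poolSize k S - 1) : ℕ) : ℤ) := by
        rw [Nat.cast_mul, Nat.cast_sub (by omega)]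
        ring
      rw [this]
      omega
    | node b r₁ r₂ => simp [treeWeight, ownWeight, preorderList]
  | node a l₁ l₂ =>
    cases r with
    | nil =>
      simp only [treeWeight, ownWeight, reduceCtorEq, and_true, if_false, if_true, mul_one,
        Nat.cast_mul]
      rw [Nat.cast_sub (by omega)]
      push_cast
      ring
    | node b r₁ r₂ => simp [treeWeight, ownWeight]

/-- The contribution of a pair of entries for the two subtrees to a weighted sum. -/
def pairTerm (n k s : ℕ) (f : List ℕ → ℤ) (e₀ e₁ : Sigma fun _ : List ℕ => ℤ) : ℤ :=
  (if n = 1 then max (e₀.2 * e₁.2 - s) 0 else e₀.2 * e₁.2) *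
    f (addLists (addLists e₀.1 e₁.1) (unitList k))

theorem addPair_spec {n k s : ℕ} {e₀ e₁ : Sigma fun _ : List ℕ => ℤ} (h₀ : 0 < e₀.2)
    (h₁ : 0 < e₁.2) {d : WeightDict} (hd : d.Pos) (f : List ℕ → ℤ) :
    (addPair n k s e₀ d e₁).Pos ∧ (addPair n k s e₀ d e₁).weightedSum f = d.weightedSum f +
      pairTerm n k s f e₀ e₁ := by
  unfold addPair pairTerm
  simp only
  by_cases hw : 0 < if n = 1 then e₀.2 * e₁.2 - (s : ℤ) else e₀.2 * e₁.2
  · rw [if_pos hw]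
    refine ⟨hd.addWeight hw, ?_⟩
    rw [WeightDict.weightedSum_addWeight]
    congr 2
    split_ifs at hw ⊢
    · exact (max_eq_left hw.le).symm
    · rfl
  · rw [if_neg hw]
    refine ⟨hd, ?_⟩
    split_ifs at hw ⊢
    · rw [max_eq_right (not_lt.1 hw), zero_mul, add_zero]
    -- For `n ≠ 1` the test never fails, since both factors are positive.
    · exact absurd (mul_pos h₀ h₁) hw

theorem countFold_spec {n : ℕ} {p : List ℕ} {s : ℕ} {call : ℕ → List ℕ → ℕ → WeightDict}
    (hleft : ∀ i : Fin n, (subDict call i (p.sum : ℤ) p).Pos)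
    (hright : ∀ (i : Fin n), ∀ e ∈ (subDict call i (p.sum : ℤ) p).entries,
      (subDict call (n - 1 - i) (-1 + ((addLists p e.1).sum : ℤ)) (addLists p e.1)).Pos)
    (f : List ℕ → ℤ) :
    (countFold n p s call).Pos ∧ (countFold n p s call).weightedSum f =
      ∑ i : Fin n, ((subDict call i (p.sum : ℤ) p).entries.map fun e₀ =>
        ((subDict call (n - 1 - i) (-1 + ((addLists p e₀.1).sum : ℤ))
          (addLists p e₀.1)).entries.map (pairTerm n p.length s f e₀)).sum).sum := by
  have h0 : WeightDict.weightedSum ∅ f = 0 := rfl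
  rw [Fin.sum_univ_def, ← zero_add (List.sum _), ← h0]
  refine WeightDict.foldl_spec (fun d i _ hd => ?_) (fun e he => by simp at he)
  refine WeightDict.foldl_spec (fun d e₀ he₀ hd => ?_) hd
  refine WeightDict.foldl_spec (fun d e₁ he₁ hd => ?_) hd
  exact addPair_spec (hleft i e₀ he₀) (hright i e₀ he₀ e₁ he₁) hd f

theorem countSpec (n : ℕ) : CountSpec n := by
  induction n using Nat.strong_induction_on with
  | _ n ih =>
    intro k S hk
    -- The algorithm never adds the current node to the pool before its recursive calls; as its
    -- index is `k`, no pool below it changes.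
    have hS : ∀ j < k, S.count j = (S ++ [k]).count j := by
      intro j hj
      rw [List.count_append, List.count_singleton]
      simp [hj.ne']
    have hS' : ∀ l, ∀ j < k, (S ++ preorderList l).count j =
        (S ++ [k] ++ preorderList l).count j := by
      intro l j hj
      rw [List.count_append, hS j hj, ← List.count_append]
    have hp := two_le_poolSize k
    generalize hs : S.count k = s
    let left : Fin n → WeightDict := fun i =>
      subDict count i ((poolList k S).sum : ℤ) (poolList k S)
    let right : Fin n → List ℕ → WeightDict := fun i t =>
      subDict count (n - 1 - i) (-1 + ((addLists (poolList k S) t).sum : ℤ))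
        (addLists (poolList k S) t)
    have hleft : ∀ i : Fin n, Represents (left i) (subTrees i k) fun T =>
        if T = .nil then (poolSize k S : ℤ) else treeWeight T (S ++ [k]) := by
      intro i
      simp only [left]
      rw [sum_poolList hk]
      exact represents_subDict hk (fun _ => ih i i.isLt) (by have := hp S; omega) hS
    have hright : ∀ (i : Fin n) l, Layered k l →
        Represents (right i (treeProfile l)) (subTrees (n - 1 - i) k) fun T =>
          if T = .nil then -1 + (poolSize k (S ++ preorderList l) : ℤ)
          else treeWeight T (S ++ [k] ++ preorderList l) := by
      intro i l hl
      simp only [right]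
      rw [addLists_poolList hl, sum_poolList hk]
      exact represents_subDict hk (fun _ => ih _ (by have := i.isLt; omega))
        (by have := hp (S ++ preorderList l); omega) (hS' l)
    have hrightpos : ∀ i, ∀ e ∈ (left i).entries, (right i e.1).Pos := by
      intro i e he
      obtain ⟨T, hT, hTe⟩ := (hleft i).exists_of_mem (t := e.1) (List.mem_map_of_mem he)
      rw [← hTe]
      exact (hright i T (mem_subTrees.1 hT).1).pos
    have hfold : ∀ f, (count n (poolList k S) s).Pos ∧
        (count n (poolList k S) s).weightedSum f = ∑ i : Fin n, ((left i).entries.map fun e₀ =>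
          ((right i e₀.1).entries.map (pairTerm n k s f e₀)).sum).sum := by
      intro f
      have h := countFold_spec (s := s) (fun i => (hleft i).pos) hrightpos f
      rwa [length_poolList, ← count_eq] at h
    refine ⟨(hfold 0).1, fun f => ?_⟩
    rw [(hfold f).2, sum_rootedTrees hk]
    refine Finset.sum_congr rfl fun i _ => ?_
    -- A single node is the only case with the subtracted term `s` and the maximum, so it is
    -- computed directly. For `n ≠ 1` the contribution is bilinear in the two arrays.
    by_cases hn : n = 1
    · subst hn
      obtain rfl : i = 0 := Subsingleton.elim _ _
      have hl : (left 0).entries = [⟨[], (poolSize k S : ℤ)⟩] := by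
        simp only [left]
        rw [sum_poolList hk]
        rfl
      have hr : (right 0 []).entries = [⟨[], -1 + (poolSize k S : ℤ)⟩] := by
        have h0 : addLists (poolList k S) [] = poolList k S := by
          simpa [treeProfile, profileOfIndices, preorderList] using
            addLists_poolList (T := .nil) trivial S
        simp only [right]
        rw [h0, sum_poolList hk]
        rfl
      have hlay : Layered (k + 1) (.node k .nil .nil) := ⟨hk, Nat.lt_succ_self k, trivial, trivial⟩
      have h0 : ((0 : Fin 1) : ℕ) = 0 := rfl
      rw [hl, List.map_singleton, List.sum_singleton, hr, List.map_singleton, List.sum_singleton,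
        h0, subTrees_zero, Finset.sum_singleton,
        Finset.sum_singleton, cast_treeWeight_node, ← treeProfile_node hlay]
      simp [pairTerm, treeProfile, profileOfIndices, preorderList, hs]
    -- The inner functional serves as test function for the left array. The right array depends on
    -- the left tree only through its profile, so it is a legitimate one.
    · have hmul : ((left i).entries.map fun e₀ =>
          ((right i e₀.1).entries.map (pairTerm n k s f e₀)).sum).sum = (left i).weightedSum fun t =>
            (right i t).weightedSum fun t' => f (addLists (addLists t t') (unitList k)) := by
        unfold WeightDict.weightedSum
        congr 1
        refine List.map_congr_left fun e₀ _ => ?_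
        rw [← List.sum_map_mul_left]
        congr 1
        refine List.map_congr_left fun e₁ _ => ?_
        simp only [pairTerm]
        rw [if_neg hn, mul_assoc]
      rw [hmul, (hleft i).sum_eq]
      refine Finset.sum_congr rfl fun l hl => ?_
      rw [mem_subTrees] at hl
      rw [(hright i l hl.1).sum_eq, Finset.mul_sum]
      refine Finset.sum_congr rfl fun r hr => ?_
      rw [mem_subTrees] at hr
      have hlay : Layered (k + 1) (.node k l r) := ⟨hk, Nat.lt_succ_self k, hl.1, hr.1⟩
      have hnil : ¬ (l = .nil ∧ r = .nil) := by
        rintro ⟨rfl, rfl⟩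
        have h1 := hl.2
        have h2 := hr.2
        have h3 := i.isLt
        simp only [preorderList, List.length_nil] at h1 h2
        omega
      rw [treeProfile_node hlay, cast_treeWeight_node, if_neg hnil, mul_assoc]

/-- The recursion runs over all layered trees with root label `k`; those that are not valid spines
have weight `0`. -/
theorem sum_rootedTrees_eq_sum_validSpines {m k : ℕ} (hk : 1 ≤ k) (G : BinaryTree ℕ → ℤ) :
    ∑ T ∈ rootedTrees m k, (treeWeight T [] : ℤ) * G T =
      ∑ T ∈ validSpines m k, (treeWeight T [] : ℤ) * G T := by
  symm
  refine Finset.sum_subset (fun T hT => ?_) fun T hT hT' => ?_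
  · rw [mem_validSpines_iff hk] at hT
    exact mem_rootedTrees.2 ⟨⟨hT.2.2.1, hT.1⟩, hT.2.1⟩
  · rw [mem_rootedTrees] at hT
    rw [mem_validSpines_iff hk] at hT'
    have : treeWeight T [] = 0 := by
      by_contra h
      exact hT' ⟨hT.1.2, hT.2, hT.1.1, Nat.pos_of_ne_zero h⟩
    rw [this, Nat.cast_zero, zero_mul]

theorem represents_count_rootPool {m k : ℕ} (hk : 1 ≤ k) :
    Represents (count m (rootPool k) 0) (validSpines m k) fun T => treeWeight T [] := by
  have h := countSpec m k [] hk
  rw [List.count_nil, ← rootPool_eq_poolList hk] at h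
  exact ⟨h.pos, fun f => by
    rw [h.sum_eq, sum_rootedTrees_eq_sum_validSpines hk fun T => f (treeProfile T)]⟩

theorem mainTheorem5 (n k : ℕ) (hn : 2 ≤ n) (hk : 1 ≤ k) :
    -- `N(n, k)` is the sum of the weights returned by the algorithm
    (numBDD n k : ℤ) = ((count (n - 2) (rootPool k) 0).entries.map Sigma.snd).sum ∧
    -- the keys are the profiles of the valid spines, and the value at a key is the sum of the
    -- cumulated weights of the valid spines with this profile
    (∀ (t : List ℕ) (w : ℤ), (count (n - 2) (rootPool k) 0).lookup t = some w ↔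
      (∃ T ∈ validSpines (n - 2) k, treeProfile T = t) ∧
      w = ∑ T ∈ validSpines (n - 2) k with treeProfile T = t, (spineWeight (n - 2) k T : ℤ)) ∧
    -- the cumulated weight of a spine does not depend on the diagram used to compute it
    (∀ B : BDD k (Fin (n - 2)), B.cumulatedWeight = spineWeight (n - 2) k B.spine) ∧
    -- memoization, started with an empty table, returns the same associative array
    (StateT.run' (countMemo (n - 2) (rootPool k) 0) ∅ : Id WeightDict).run =
      count (n - 2) (rootPool k) 0 := by
  have hrep := represents_count_rootPool (m := n - 2) hk
  refine ⟨?_, fun t w => ?_, fun B => ?_, run'_countMemo _ _ _⟩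
  -- The constant test function gives the total of all entries.
  · have h := hrep.sum_eq fun _ => 1
    simp only [WeightDict.weightedSum, mul_one] at h
    rw [numBDD_eq_sum hk, Nat.cast_sum]
    exact h.symm
  · have hsum : ∑ T ∈ validSpines (n - 2) k with treeProfile T = t,
        (spineWeight (n - 2) k T : ℤ) =
        (count (n - 2) (rootPool k) 0).weightedSum fun t' => if t' = t then 1 else 0 := by
      rw [hrep.sum_eq, Finset.sum_filter]
      refine Finset.sum_congr rfl fun T hT => ?_
      rw [spineWeight_eq hk hT, mul_ite, mul_one, mul_zero]
    rw [hrep.pos.lookup_eq_some_iff, ← hsum]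
    -- What remains is that the sum over a profile is positive exactly when some valid spine has
    -- this profile, because every valid spine has positive weight.
    refine and_congr_left fun hw => ?_
    rw [hw]
    constructor
    · intro h
      obtain ⟨T, hT, -⟩ := Finset.exists_ne_zero_of_sum_ne_zero h.ne'
      rw [Finset.mem_filter] at hT
      exact ⟨T, hT⟩
    · intro ⟨T, hT, hTt⟩
      refine Finset.sum_pos (fun T hT => ?_) ⟨T, Finset.mem_filter.2 ⟨hT, hTt⟩⟩
      have hT := (Finset.mem_filter.1 hT).1
      rw [spineWeight_eq hk hT]
      exact_mod_cast ((mem_validSpines_iff hk).1 hT).2.2.2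
  · rw [B.spineWeight_spine hk, B.cumulatedWeight_eq hk]
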